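/- For $n\ge -1$ let $S_n$ be the coefficients of the formal solution $S=\sum_{j\ge -1}\eta^{-j}S_j(x)$ of the Riccati equation $\frac{dS}{dx}+S^2=\eta^2x$ with $S_{-1}=x^{1/2}$, put $S_{\rm odd}=\sum_{j\ge -1}\eta^{-2j-1}S_{2j+1}$, and let $$\psi_\pm=\frac{1}{\sqrt{S_{\rm odd}}}\exp\Big(\pm\int_0^xS_{\rm odd}\,dx\Big)=\exp\Big(\pm\tfrac23x^{3/2}\eta\Big)\sum_{n\ge 0}f_n^{\pm}(x)\,\eta^{-n-\frac12}$$ be the WKB solutions of the Airy equation $\big(-\frac{d^2}{dx^2}+\eta^2x\big)\psi=0$, where $\int_0^x$ is one half of the term-by-term contour integral that starts at $x$ on the second sheet of the Riemann surface of $\sqrt x$, goes once around the origin counterclockwise, and ends at $x$ on the first sheet. Let $$\psi_{\pm,B}(x,y)=\sum_{n\ge 0}\frac{f_n^{\pm}(x)}{\Gamma(n+\frac12)}\Big(y\pm\tfrac23x^{3/2}\Big)^{n-\frac12}$$ be their Borel transforms. Let $g=g(x,y)$ be the algebraic function defined by $(9y^2-4x^3)g^3+3xg+1=0$. For $x\neq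 0$ and $0<|y\pm\frac23x^{3/2}|<\frac43|x|^{3/2}$ the series $\psi_{\pm,B}$ converges. On every domain in $\mathbb C^2$, every holomorphic branch of $g$, and every branch of $\psi_{\pm,B}$ that is obtained from the sum of the series by analytic continuation, satisfies the system $$\Big(-\frac{\partial^2}{\partial x^2}+x\frac{\partial^2}{\partial y^2}\Big)u=0,\qquad \Big(2x\frac{\partial}{\partial x}+3y\frac{\partial}{\partial y}+2\Big)u=0 .$$ On every domain on which two different holomorphic branches of $g$ are given, every such branch of $\psi_{\pm,B}$ is a linear combination of these two with constant coefficients. In particular, the branches of $\psi_{\pm,B}$ are algebraic functions of $(x,y)$. -/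

import Mathlib

noncomputable section

namespace AiryWKB

/-- The formal solution `S = ∑_{j ≥ -1} η^{-j} S_j` of the Riccati equation
`dS/dx + S² = η² x`: `airyS n` is the coefficient `S_{n-1}`, regarded as a function on the Riemann
surface of `√x`, with global coordinate `r = √x`. So `x = r²`, `d/dx = (1 / (2 r)) d/dr`,
`S_{-1} = r` and
`S_{j+1} = -(1 / (2 S_{-1})) (dS_j/dx + ∑_{k=0}^{j} S_k S_{j-k})` for `j = m - 1 ≥ -1`. -/
def airyS : ℕ → ℂ → ℂ
  | 0 => fun r => r
  | m + 1 => fun r =>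
      -(1 / (2 * r)) *
        (deriv (airyS m) r / (2 * r) + ∑ k : Fin m, airyS (k + 1) r * airyS (m - k) r)
  termination_by n => n
  decreasing_by all_goals omega

/-- One half of the contour integral `∫ f dx` over the path that starts at the point over `x = r²`
on the other sheet of the Riemann surface of `√x` (the point `-r`), goes once around the origin
counterclockwise along `x exp(iθ)`, `-2π ≤ θ ≤ 0`, and ends at the point `r`. -/
def halfContour (f : ℂ → ℂ) (r : ℂ) : ℂ :=
  (1 / 2) * ∫ θ in (-(2 * Real.pi))..(0 : ℝ),
    f (r * Complex.exp (Complex.I * θ / 2)) * (Complex.I * r ^ 2 * Complex.exp (Complex.I * θ))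

/-- The coefficient of `η` in `∫_0^x S_odd dx`. -/
def airyAction (r : ℂ) : ℂ := halfContour (airyS 0) r

/-- The formal series `η⁻¹ S_odd`, `S_odd = ∑_{j ≥ -1} η^{-2j-1} S_{2j+1}`,
as a power series in `η⁻¹`. -/
def oddSeries (r : ℂ) : PowerSeries ℂ :=
  PowerSeries.mk fun n => if Even n then airyS n r else 0

/-- The part of `∫_0^x S_odd dx` (term-by-term integral) of negative order in `η`, as a power series
in `η⁻¹`. Thus `∫_0^x S_odd dx = η * airyAction r + phaseSeries r`. -/
def phaseSeries (r : ℂ) : PowerSeries ℂ :=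
  PowerSeries.mk fun n => if Odd n then halfContour (airyS (n + 1)) r else 0

/-- The WKB solution `ψ = S_odd^{-1/2} exp (ε ∫_0^x S_odd dx)`, where `ε = ± 1`, at a point given by
`q = x^{1/4}`, is
`exp (ε η a) * η^{-1/2} * (f_0 + f_1 η⁻¹ + f_2 η⁻² + ⋯)` with `a = airyAction (q ^ 2)`;
this is the power series `f_0 + f_1 η⁻¹ + ⋯`. Here
`(η⁻¹ S_odd)^{-1/2} = q⁻¹ (1 + (q⁻² η⁻¹ S_odd - 1))^{-1/2}` is expanded by the binomial series. -/
def wkbSeries (ε q : ℂ) : PowerSeries ℂ :=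
  PowerSeries.C q⁻¹ *
    (PowerSeries.binomialSeries ℂ (-1 / 2 : ℂ)).subst
      (PowerSeries.C (q ^ 2)⁻¹ * oddSeries (q ^ 2) - 1) *
    (PowerSeries.exp ℂ).subst (PowerSeries.C ε * phaseSeries (q ^ 2))

/-- The terms of the Borel transform: that of `exp (ε η a) f_n η^{-(n + 1/2)}` is
`f_n (y + ε a)^{n - 1/2} / Γ(n + 1/2)`, where `(y + ε a)^{1/2} = σ`. -/
def borelTerm (ε q σ : ℂ) (n : ℕ) : ℂ :=
  PowerSeries.coeff n (wkbSeries ε q) * σ ^ (2 * (n : ℤ) - 1) / Complex.Gamma ((n : ℂ) + 1 / 2)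

/-- `IsBorelBranch ε W Ψ`: the function `Ψ` is a (single-valued holomorphic) branch, on the domain
`W ⊆ ℂ²`, of the multivalued function `ψ_{±,B}(x, y)`, with `ε = ± 1`.
Either `Ψ` is the sum of the Borel transform, for some branches `q` of `x^{1/4}` and `σ` of
`(y + ε a)^{1/2}` on `W`, `a` being `(2 / 3) x^{3/2}`, on a domain where
`0 < |y + ε a| < |2 a|`; or it arises from such a sum by analytic continuation along a finite
chain of domains. -/
inductive IsBorelBranch (ε : ℂ) : Set (ℂ × ℂ) → (ℂ × ℂ → ℂ) → Prop
  | sum (W : Set (ℂ × ℂ)) (Ψ q σ : ℂ × ℂ → ℂ) (hW : IsOpen W) (hW' : IsConnected W)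
      (hq : AnalyticOnNhd ℂ q W) (hσ : AnalyticOnNhd ℂ σ W)
      (hqx : ∀ p ∈ W, q p ^ 4 = p.1) (hσy : ∀ p ∈ W, σ p ^ 2 = p.2 + ε * airyAction (q p ^ 2))
      (hx : ∀ p ∈ W, q p ≠ 0) (hσ0 : ∀ p ∈ W, σ p ≠ 0)
      (hdisc : ∀ p ∈ W, ‖σ p ^ 2‖ < ‖2 * airyAction (q p ^ 2)‖)
      (hΨ : ∀ p ∈ W, Ψ p = ∑' n, borelTerm ε (q p) (σ p) n) :
      IsBorelBranch ε W Ψ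
  | continuation (W W' : Set (ℂ × ℂ)) (Ψ Ψ' : ℂ × ℂ → ℂ) (h : IsBorelBranch ε W Ψ)
      (hW : IsOpen W') (hW' : IsConnected W') (hΨ' : AnalyticOnNhd ℂ Ψ' W')
      (p : ℂ × ℂ) (hp : p ∈ W ∩ W') (heq : ∀ᶠ z in nhds p, Ψ' z = Ψ z) :
      IsBorelBranch ε W' Ψ'

/-- `g` is a branch on `W` of the algebraic function defined by
`(9 y² - 4 x³) g³ + 3 x g + 1 = 0`. -/
def IsCubicBranch (W : Set (ℂ × ℂ)) (g : ℂ × ℂ → ℂ) : Prop :=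
  AnalyticOnNhd ℂ g W ∧
    ∀ p ∈ W, (9 * p.2 ^ 2 - 4 * p.1 ^ 3) * g p ^ 3 + 3 * p.1 * g p + 1 = 0

/-- `u` solves the system `(-∂²/∂x² + x ∂²/∂y²) u = 0`, `(2x ∂/∂x + 3y ∂/∂y + 2) u = 0` on `W`. -/
def SolvesSystem (W : Set (ℂ × ℂ)) (u : ℂ × ℂ → ℂ) : Prop :=
  ∀ p ∈ W,
    -iteratedDeriv 2 (fun x => u (x, p.2)) p.1
        + p.1 * iteratedDeriv 2 (fun y => u (p.1, y)) p.2 = 0 ∧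
      2 * p.1 * deriv (fun x => u (x, p.2)) p.1
        + 3 * p.2 * deriv (fun y => u (p.1, y)) p.2 + 2 * u p = 0

/-- `u` is an algebraic function of `(x, y)` on `W`: it satisfies a nontrivial polynomial equation
`P(x, y, u) = 0`. -/
def IsAlgebraicFunctionOn (W : Set (ℂ × ℂ)) (u : ℂ × ℂ → ℂ) : Prop :=
  ∃ P : MvPolynomial (Fin 3) ℂ, P ≠ 0 ∧ ∀ p ∈ W, MvPolynomial.eval ![p.1, p.2, u p] P = 0

end AiryWKB

end

/-! ### Homogeneity of the formal Riccati solution and the half contour integral. -/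

noncomputable section

namespace AiryWKB

open PowerSeries

/-! By homogeneity each coefficient of `S` is a constant times a power of `√x`, so `d/dx` can be
traded for a derivative in `X = η⁻¹`. Linearizing the Riccati equation then gives a second order
equation for `wkbSeries` in `X`, that is, a two-term recursion (`coeff_wkbSeries`). Dividing by `Γ(n
+ 1/2)` turns the Borel transform into an elementary factor times `F(1/6, 5/6; 1/2; w)` with `w =
(3/4) ε σ² / q⁶` (`borelTerm_eq`); in particular it converges for `|w| < 1`.

This function is algebraic: `cos u · F(sin² u) = cos (2u/3)`, and the triple angle formula gives a
polynomial relation (`hypFun_algebraic`). In the variables `(x, y)` it says that the transform is a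
root of `DifferenceSextic`, whose roots are the `κ (g_i - g_j)`, `κ² = ε/π`
(`differenceSextic_borel`). A polynomial relation survives analytic continuation, so every branch
satisfies it (`IsBorelBranch.differenceSextic`).

Everything else follows from the sextic. It gives algebraicity at once. Off the discriminant, two
values of `g` are rational in `u`, so `u` inherits the system from `g`, for which it is implicit
differentiation (`system_of_implicit`); density handles the other points. Given two different
branches of `g`, the sextic splits into factors linear in `u`, and one of them vanishes identically
(`exists_linear_comb`). -/

theorem airyS_succ (m : ℕ) (r : ℂ) : airyS (m + 1) r = -(1 / (2 * r)) *
    (deriv (airyS m) r / (2 * r) + ∑ k ∈ Finset.range m, airyS (k + 1) r * airyS (m - k) r) := by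
  rw [airyS, Finset.sum_range]

/-- Homogeneity of the coefficients of the formal solution. -/
theorem airyS_eq (n : ℕ) : ∀ r : ℂ, r ≠ 0 → airyS n r = airyS n 1 * r ^ (1 - 3 * (n : ℤ)) := by
  induction n using Nat.strong_induction_on with
  | _ n ih =>
  rcases n with _ | m
  · intro r hr
    simp [airyS]
  · have hd : ∀ r : ℂ, r ≠ 0 →
        deriv (airyS m) r = airyS m 1 * ((1 - 3 * m) * r ^ (-3 * (m : ℤ))) := by
      intro r hr
      have h1 : airyS m =ᶠ[nhds r] fun z => airyS m 1 * z ^ (1 - 3 * (m : ℤ)) := by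
        filter_upwards [isOpen_ne.mem_nhds hr] with z hz
        exact ih m (Nat.lt_succ_self m) z hz
      rw [h1.deriv_eq]
      have h2 := ((hasDerivAt_zpow (1 - 3 * (m : ℤ)) r (Or.inl hr)).const_mul (airyS m 1)).deriv
      rw [h2]
      push_cast
      congr 3
      ring
    intro r hr
    have hsum : ∑ k ∈ Finset.range m, airyS (k + 1) r * airyS (m - k) r =
        (∑ k ∈ Finset.range m, airyS (k + 1) 1 * airyS (m - k) 1) * r ^ (-1 - 3 * (m : ℤ)) := by
      rw [Finset.sum_mul]
      refine Finset.sum_congr rfl fun k hk => ?_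
      have hk := Finset.mem_range.1 hk
      rw [ih (k + 1) (by omega) r hr, ih (m - k) (by omega) r hr, Nat.cast_sub hk.le]
      have : r ^ (-1 - 3 * (m : ℤ)) =
          r ^ (1 - 3 * ((k + 1 : ℕ) : ℤ)) * r ^ (1 - 3 * ((m : ℤ) - k)) := by
        rw [← zpow_add₀ hr]
        congr 1
        push_cast
        ring
      rw [this]
      ring
    rw [airyS_succ, airyS_succ, hd r hr, hd 1 one_ne_zero, hsum]
    have e1 : r ^ (-3 * (m : ℤ)) = r ^ (-1 - 3 * (m : ℤ)) * r := by
      rw [← zpow_add_one₀ hr]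
      congr 1
      ring
    have e2 : r ^ (1 - 3 * ((m + 1 : ℕ) : ℤ)) = r ^ (-1 - 3 * (m : ℤ)) * r⁻¹ := by
      rw [← zpow_sub_one₀ hr]
      congr 1
      push_cast
      ring
    rw [e1, e2]
    simp only [one_zpow]
    field_simp

/-- Half of the contour integral of an odd power of `√x`. -/
theorem halfContour_zpow (f : ℂ → ℂ) (c : ℂ) (m : ℤ) (hm : Odd m)
    (hf : ∀ z : ℂ, z ≠ 0 → f z = c * z ^ m) (r : ℂ) (hr : r ≠ 0) :
    halfContour f r = c * (2 / (m + 2)) * r ^ (m + 2) := by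
  have hm2 : (m : ℂ) + 2 ≠ 0 := by
    have : m + 2 ≠ 0 := by
      obtain ⟨k, rfl⟩ := hm
      omega
    exact_mod_cast this
  have key : ∀ θ : ℝ, f (r * Complex.exp (Complex.I * θ / 2)) *
      (Complex.I * r ^ 2 * Complex.exp (Complex.I * θ)) =
      (c * r ^ (m + 2) * Complex.I) * Complex.exp (Complex.I * (m + 2) / 2 * θ) := by
    intro θ
    rw [hf _ (mul_ne_zero hr (Complex.exp_ne_zero _)), mul_zpow, ← Complex.exp_int_mul]
    have e1 : Complex.exp (Complex.I * (m + 2) / 2 * θ) =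
        Complex.exp (m * (Complex.I * θ / 2)) * Complex.exp (Complex.I * θ) := by
      rw [← Complex.exp_add]
      congr 1
      ring
    have e2 : r ^ (m + 2) = r ^ m * r ^ 2 := by
      rw [zpow_add₀ hr]
      rfl
    rw [e1, e2]
    ring
  have hI : Complex.I * (m + 2) / 2 ≠ 0 := by
    simp [hm2]
  -- For odd `m` the primitive changes sign between the two sheets. The endpoints contribute
  -- equally, and the factor 1/2 leaves the primitive without a constant.
  have hexp : Complex.exp (Complex.I * (m + 2) / 2 * ((-(2 * Real.pi) : ℝ) : ℂ)) = -1 := by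
    obtain ⟨k, rfl⟩ := hm
    have : Complex.I * ((2 * k + 1 : ℤ) + 2) / 2 * ((-(2 * Real.pi) : ℝ) : ℂ) =
        Real.pi * Complex.I + ((-k - 2 : ℤ) : ℂ) * (2 * Real.pi * Complex.I) := by
      push_cast
      ring
    rw [this, Complex.exp_add, Complex.exp_int_mul_two_pi_mul_I, Complex.exp_pi_mul_I]
    ring
  unfold halfContour
  simp_rw [key]
  rw [intervalIntegral.integral_const_mul, integral_exp_mul_complex hI, hexp]
  simp only [Complex.ofReal_zero, mul_zero, Complex.exp_zero]
  have := Complex.I_ne_zero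
  field_simp
  ring

theorem airyAction_eq (r : ℂ) (hr : r ≠ 0) : airyAction r = 2 / 3 * r ^ 3 := by
  have := halfContour_zpow (airyS 0) 1 1 odd_one (fun z _ => by simp [airyS]) r hr
  rw [airyAction, this]
  norm_num

/-! ### Formal differential equations for the binomial series, the exponential and the Riccati
solution. -/

theorem binomialSeries_derivative (r : ℂ) :
    (1 + X) * d⁄dX ℂ (PowerSeries.binomialSeries ℂ r) = C r * PowerSeries.binomialSeries ℂ r := by
  ext n
  have key : ∀ n : ℕ, Ring.choose r (n + 1) * (n + 1) = (r - n) * Ring.choose r n := by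
    intro n
    have h1 := Ring.descPochhammer_eq_factorial_smul_choose r n
    have h2 := Ring.descPochhammer_eq_factorial_smul_choose r (n + 1)
    rw [descPochhammer_succ_right, Polynomial.smeval_mul, h1] at h2
    simp [Nat.factorial_succ, Polynomial.smeval_sub, Polynomial.smeval_natCast] at h2
    have : (n.factorial : ℂ) ≠ 0 := by exact_mod_cast n.factorial_ne_zero
    apply mul_left_cancel₀ this
    linear_combination -h2
  rw [add_mul, one_mul, map_add, coeff_C_mul, coeff_derivative, binomialSeries_coeff,
    binomialSeries_coeff]
  rcases n with _ | n
  · have := key 0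
    simp at this ⊢
  · rw [coeff_succ_X_mul, coeff_derivative, binomialSeries_coeff]
    have := key (n + 1)
    push_cast at this ⊢
    simp only [smul_eq_mul, mul_one]
    linear_combination this

/-- The derivative of `(1 + u)^r`. -/
theorem derivative_binomialSeries_subst (r : ℂ) (u : ℂ⟦X⟧) (hu : constantCoeff u = 0) :
    (1 + u) * d⁄dX ℂ ((PowerSeries.binomialSeries ℂ r).subst u) =
      C r * (PowerSeries.binomialSeries ℂ r).subst u * d⁄dX ℂ u := by
  have hs : HasSubst u := HasSubst.of_constantCoeff_zero' hu
  have h := congrArg (fun f : ℂ⟦X⟧ => f.subst u) (binomialSeries_derivative r)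
  simp only [subst_mul hs, subst_add hs, subst_X hs] at h
  have h1 : (1 : ℂ⟦X⟧).subst u = (1 : ℂ⟦X⟧) := by
    rw [← coe_substAlgHom hs, map_one]
  have h2 : (C r : ℂ⟦X⟧).subst u = (C r : ℂ⟦X⟧) := subst_C r
  rw [h1, h2] at h
  rw [derivative_subst hs, ← mul_assoc, h]

theorem derivative_exp_subst (u : ℂ⟦X⟧) (hu : constantCoeff u = 0) :
    d⁄dX ℂ ((PowerSeries.exp ℂ).subst u) = (PowerSeries.exp ℂ).subst u * d⁄dX ℂ u := by
  rw [derivative_subst (HasSubst.of_constantCoeff_zero' hu), derivative_exp]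

/-- The Riccati equation for the generating function of a sequence. -/
theorem riccati_mk (t : ℕ → ℂ) (l : ℂ) (h0 : t 0 = 1)
    (h : ∀ m : ℕ, 2 * t (m + 1) + ∑ k ∈ Finset.range m, t (k + 1) * t (m - k) +
      l * (1 - 3 * m) / 2 * t m = 0) :
    (mk t) ^ 2 + C (l / 2) * X * (mk t - 3 * (X * d⁄dX ℂ (mk t))) = 1 := by
  -- The multiplier `1 - 3n` is the exponent of `√x` in `airyS n`; this is where `d/dx` becomes
  -- `d/dX`.
  have hX : ∀ n : ℕ, coeff n (mk t - 3 * (X * d⁄dX ℂ (mk t))) = (1 - 3 * n) * t n := by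
    intro n
    have h3 : (3 : ℂ⟦X⟧) = C 3 := (map_ofNat C 3).symm
    rw [h3, map_sub, coeff_C_mul, coeff_mk]
    rcases n with _ | n
    · simp
    · rw [coeff_succ_X_mul, coeff_derivative, coeff_mk]
      push_cast
      ring
  ext n
  rw [map_add, mul_assoc, coeff_C_mul, sq, coeff_mul, Finset.Nat.sum_antidiagonal_eq_sum_range_succ
    (fun i j => coeff i (mk t) * coeff j (mk t))]
  simp only [coeff_mk]
  rcases n with _ | m
  · simp [h0]
  · rw [coeff_succ_X_mul, hX, Finset.sum_range_succ, Finset.sum_range_succ']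
    have e : ∑ k ∈ Finset.range m, t (k + 1) * t (m + 1 - (k + 1)) =
        ∑ k ∈ Finset.range m, t (k + 1) * t (m - k) :=
      Finset.sum_congr rfl fun k _ => by rw [Nat.add_sub_add_right]
    rw [e, coeff_one, if_neg (Nat.succ_ne_zero m)]
    simp only [Nat.sub_zero, Nat.sub_self, h0]
    linear_combination h m

end AiryWKB
end

/-! ### The two-term recursion for the WKB coefficients. -/

noncomputable section

namespace AiryWKB

open PowerSeries

/-- The first order equation for `F = O^{-1/2} exp (ε Φ)`, from the Riccati equations for `O + N` and
`O - N`. -/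
theorem wkb_first_order (O N B E Φ e L : ℂ⟦X⟧) (hO : O ≠ 0)
    (hp : 2 * (O + N) ^ 2 + L * X * ((O + N) - 3 * (X * d⁄dX ℂ (O + N))) = 2)
    (hm : 2 * (O - N) ^ 2 - L * X * ((O - N) - 3 * (X * d⁄dX ℂ (O - N))) = 2)
    (hB : 2 * (O * d⁄dX ℂ B) = - B * d⁄dX ℂ O)
    (hE : d⁄dX ℂ E = E * (e * d⁄dX ℂ Φ))
    (hΦ : 3 * (L * (X * (X * d⁄dX ℂ Φ))) = -2 * (O - 1)) :
    6 * (L * X * (X * d⁄dX ℂ (B * E))) = B * E * (-4 * N - L * X - 4 * e * (O - 1)) := by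
  simp only [map_add, map_sub, Derivation.leibniz, smul_eq_mul] at hp hm ⊢
  have h2 : (2 : ℂ⟦X⟧) ≠ 0 := by
    rw [← map_ofNat C 2]
    simp
  -- The difference of `hp` and `hm` reads `4N + LX = 3LX² O'/O`: up to scaling, the even part is
  -- the logarithmic derivative of `O^{-1/2}`. Multiplying by `2O` avoids the division.
  apply mul_left_cancel₀ (mul_ne_zero h2 hO)
  linear_combination 6 * L * X ^ 2 * E * hB + 12 * O * L * X ^ 2 * B * hE +
    4 * O * B * E * e * hΦ + B * E * (hp - hm)

/-- The linear second order equation for `F`, from a Riccati equation for `T` and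
`F T = (1 - z / 4) F - (3 / 2) z X F'`, where `z = k X`. -/
theorem wkb_second_order (F T : ℂ⟦X⟧) (k : ℂ) (hk : k ≠ 0)
    (hT : 2 * T ^ 2 + C k * X * (T - 3 * (X * d⁄dX ℂ T)) = 2)
    (hF : 4 * (F * T) = (4 - C k * X) * F - 6 * (C k * X * (X * d⁄dX ℂ F))) :
    48 * d⁄dX ℂ F = C k * (36 * (X * d⁄dX ℂ (X * d⁄dX ℂ F)) + 36 * (X * d⁄dX ℂ F) + 5 * F) := by
  -- Differentiating `hF` expresses `F T'` through `F`, `F'`, `F''` and `T`. Inserted in the Riccati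
  -- equation, this cancels the nonlinear terms up to a common factor `k X²`.
  have hd := congrArg (d⁄dX ℂ) hF
  have h4 : d⁄dX ℂ (4 : ℂ⟦X⟧) = 0 := by rw [← map_ofNat C 4, derivative_C]
  have h6 : d⁄dX ℂ (6 : ℂ⟦X⟧) = 0 := by rw [← map_ofNat C 6, derivative_C]
  simp only [map_sub, Derivation.leibniz, smul_eq_mul, h4, h6, derivative_X, derivative_C,
    mul_zero, add_zero, mul_one, zero_sub] at hd ⊢
  have hX : (X : ℂ⟦X⟧) ≠ 0 := X_ne_zero
  have hk' : (C k : ℂ⟦X⟧) ≠ 0 := by simpa using hk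
  apply mul_left_cancel₀ (mul_ne_zero hk' (pow_ne_zero 2 hX))
  linear_combination -8 * F * hT + 4 * T * hF + (4 + C k * X) * hF - 6 * (C k * X) * X * hd

/-- The coefficients of `q^{-2} η^{-1} S`, as a power series in `η^{-1}`. -/
def ratioS (q : ℂ) (n : ℕ) : ℂ := (q ^ 2)⁻¹ * airyS n (q ^ 2)

theorem ratioS_zero (q : ℂ) (hq : q ≠ 0) : ratioS q 0 = 1 := by
  simp [ratioS, airyS, hq]

theorem ratioS_rec (q : ℂ) (hq : q ≠ 0) (m : ℕ) :
    2 * ratioS q (m + 1) + ∑ k ∈ Finset.range m, ratioS q (k + 1) * ratioS q (m - k) +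
      (q ^ 6)⁻¹ * (1 - 3 * m) / 2 * ratioS q m = 0 := by
  have hr : q ^ 2 ≠ 0 := pow_ne_zero 2 hq
  have h1 : airyS m =ᶠ[nhds (q ^ 2)] fun z => airyS m 1 * z ^ (1 - 3 * (m : ℤ)) := by
    filter_upwards [isOpen_ne.mem_nhds hr] with z hz
    exact airyS_eq m z hz
  have h2 : deriv (airyS m) (q ^ 2) = (1 - 3 * m) * airyS m (q ^ 2) * (q ^ 2)⁻¹ := by
    rw [h1.deriv_eq, ((hasDerivAt_zpow (1 - 3 * (m : ℤ)) _ (Or.inl hr)).const_mul _).deriv,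
      airyS_eq m _ hr, zpow_sub_one₀ hr]
    push_cast
    ring
  have h3 : ∑ k ∈ Finset.range m, ratioS q (k + 1) * ratioS q (m - k) =
      (q ^ 2)⁻¹ ^ 2 * ∑ k ∈ Finset.range m, airyS (k + 1) (q ^ 2) * airyS (m - k) (q ^ 2) := by
    rw [Finset.mul_sum]
    exact Finset.sum_congr rfl fun k _ => by simp only [ratioS]; ring
  rw [h3, ratioS, ratioS, airyS_succ, h2]
  field_simp
  ring

/-- The Riccati equation, after `η ↦ ± η`. -/
theorem ratioS_riccati (q : ℂ) (hq : q ≠ 0) (e : ℂ) :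
    (mk fun n => e ^ n * ratioS q n) ^ 2 + C (e * (q ^ 6)⁻¹ / 2) * X *
      ((mk fun n => e ^ n * ratioS q n) -
        3 * (X * d⁄dX ℂ (mk fun n => e ^ n * ratioS q n))) = 1 := by
  refine riccati_mk _ _ (by simp [ratioS_zero q hq]) fun m => ?_
  have h : ∑ k ∈ Finset.range m, e ^ (k + 1) * ratioS q (k + 1) * (e ^ (m - k) * ratioS q (m - k)) =
      e ^ (m + 1) * ∑ k ∈ Finset.range m, ratioS q (k + 1) * ratioS q (m - k) := by
    rw [Finset.mul_sum]
    refine Finset.sum_congr rfl fun k hk => ?_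
    have : m + 1 = (k + 1) + (m - k) := by
      have := Finset.mem_range.1 hk
      omega
    rw [this, pow_add]
    ring
  rw [h]
  linear_combination e ^ (m + 1) * ratioS_rec q hq m

/-- Integrating the power `1 - 3(n + 1)` of `√x` in `x` gives the power `-3n` with factor `2/(-3n)`.
Summed over `n`, this expresses the `X`-derivative of the phase by the odd part of `S`. -/
theorem coeff_phaseSeries (q : ℂ) (hq : q ≠ 0) (n : ℕ) (hn : Odd n) :
    3 * (n * coeff n (phaseSeries (q ^ 2))) = -2 * q ^ 6 * ratioS q (n + 1) := by
  have hr : q ^ 2 ≠ 0 := pow_ne_zero 2 hq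
  have hodd : Odd (1 - 3 * ((n + 1 : ℕ) : ℤ)) := by
    obtain ⟨k, rfl⟩ := hn
    exact ⟨-3 * k - 3, by push_cast; ring⟩
  have hn0 : (n : ℂ) ≠ 0 := by exact_mod_cast hn.pos.ne'
  rw [phaseSeries, coeff_mk, if_pos hn,
    halfContour_zpow _ _ _ hodd (fun z hz => airyS_eq (n + 1) z hz) _ hr, ratioS,
    airyS_eq (n + 1) _ hr, zpow_add₀ hr]
  have hd : (((1 - 3 * ((n + 1 : ℕ) : ℤ) : ℤ) : ℂ) + 2) = -3 * n := by
    push_cast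
    ring
  rw [hd, show (q ^ 2) ^ (2 : ℤ) = q ^ 4 by rw [zpow_ofNat]; ring]
  field_simp

theorem constantCoeff_phaseSeries (r : ℂ) : constantCoeff (phaseSeries r) = 0 := by
  rw [← coeff_zero_eq_constantCoeff_apply, phaseSeries, coeff_mk]
  simp

/-- The first coefficient of a WKB solution, and the recursion for its coefficients. -/
theorem coeff_wkbSeries (ε q : ℂ) (hε : ε = 1 ∨ ε = -1) (hq : q ≠ 0) :
    coeff 0 (wkbSeries ε q) = q⁻¹ ∧
    ∀ n : ℕ, 48 * ((n + 1) * coeff (n + 1) (wkbSeries ε q)) =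
      ε * (q ^ 6)⁻¹ * (36 * n ^ 2 + 36 * n + 5) * coeff n (wkbSeries ε q) := by
  set O : ℂ⟦X⟧ := C (q ^ 2)⁻¹ * oddSeries (q ^ 2) with hOdef
  set Φ := phaseSeries (q ^ 2) with hΦdef
  set B := (PowerSeries.binomialSeries ℂ (-1 / 2 : ℂ)).subst (O - 1) with hBdef
  set E := (PowerSeries.exp ℂ).subst (C ε * Φ) with hEdef
  have hwkb : wkbSeries ε q = C q⁻¹ * (B * E) := by
    rw [wkbSeries, mul_assoc]
  have he2 : ε ^ 2 = 1 := by rcases hε with rfl | rfl <;> norm_num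
  have he0 : ε ≠ 0 := fun h => by simp [h] at he2
  have hOc : ∀ n, coeff n O = if Even n then ratioS q n else 0 := by
    intro n
    rw [hOdef, coeff_C_mul, oddSeries, coeff_mk]
    split_ifs <;> simp [ratioS]
  clear_value O
  have hO1 : constantCoeff O = 1 := by
    rw [← coeff_zero_eq_constantCoeff_apply, hOc]
    simp [ratioS_zero q hq]
  have hO0 : O ≠ 0 := fun h => by simp [h] at hO1
  -- Because of the index shift, `N` collects the `S_j` with `j` even. The substitution `X ↦ -X`
  -- sends `O + N` to `O - N`, whence two Riccati equations.
  set N : ℂ⟦X⟧ := mk fun n => if Even n then 0 else ratioS q n with hN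
  have hsum : ∀ e : ℂ, e ^ 2 = 1 → (mk fun n => e ^ n * ratioS q n) = O + C e * N := by
    intro e he
    ext n
    rw [map_add, coeff_C_mul, hOc, hN, coeff_mk, coeff_mk]
    rcases Nat.even_or_odd n with h | h
    · simp only [h, if_true]
      obtain ⟨k, rfl⟩ := h
      rw [← two_mul, pow_mul, he]
      simp
    · simp only [Nat.not_even_iff_odd.2 h, if_false]
      obtain ⟨k, rfl⟩ := h
      rw [pow_add, pow_mul, he]
      simp
  have hR : ∀ e : ℂ, e ^ 2 = 1 → 2 * (O + C e * N) ^ 2 + C (e * (q ^ 6)⁻¹) * X *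
      ((O + C e * N) - 3 * (X * d⁄dX ℂ (O + C e * N))) = 2 := by
    intro e he
    have h := ratioS_riccati q hq e
    rw [hsum e he] at h
    have h2 : (C (e * (q ^ 6)⁻¹) : ℂ⟦X⟧) = 2 * C (e * (q ^ 6)⁻¹ / 2) := by
      rw [← map_ofNat C 2, ← map_mul]
      congr 1
      ring
    rw [h2]
    linear_combination 2 * h
  have hU : constantCoeff (O - 1) = 0 := by simp [hO1]
  have hV : constantCoeff (C ε * Φ) = 0 := by simp [hΦdef, constantCoeff_phaseSeries]
  have hB : 2 * (O * d⁄dX ℂ B) = -B * d⁄dX ℂ O := by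
    have h := derivative_binomialSeries_subst (-1 / 2) (O - 1) hU
    have h2 : (2 : ℂ⟦X⟧) * C (-1 / 2) = -1 := by
      rw [← map_ofNat C 2, ← map_mul]
      norm_num
    simp only [add_sub_cancel, map_sub, derivative_one, sub_zero] at h
    rw [h]
    linear_combination B * d⁄dX ℂ O * h2
  have hE : d⁄dX ℂ E = E * (C ε * d⁄dX ℂ Φ) := by
    rw [hEdef, derivative_exp_subst _ hV]
    simp [Derivation.leibniz]
  have hΦ : 3 * (C (q ^ 6)⁻¹ * (X * (X * d⁄dX ℂ Φ))) = -2 * (O - 1) := by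
    ext n
    rw [← map_ofNat C 3, ← map_ofNat C 2, ← map_neg, coeff_C_mul, coeff_C_mul, coeff_C_mul, map_sub,
      hOc, coeff_one]
    rcases n with _ | _ | n
    · simp [ratioS_zero q hq]
    · simp
    · rw [coeff_succ_X_mul, coeff_succ_X_mul, coeff_derivative, if_neg (by omega : ¬ n + 1 + 1 = 0)]
      rcases Nat.even_or_odd (n + 1) with h | h
      · have h' : ¬ Even (n + 1 + 1) := by simpa [Nat.even_add_one] using h
        rw [if_neg h', hΦdef, phaseSeries, coeff_mk, if_neg (Nat.not_odd_iff_even.2 h)]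
        simp
      · have h' : Even (n + 1 + 1) := h.add_one
        rw [if_pos h']
        have := coeff_phaseSeries q hq (n + 1) h
        push_cast at this
        field_simp
        linear_combination this
  have h1 := wkb_first_order O N B E Φ (C ε) (C (q ^ 6)⁻¹) hO0
    (by simpa using hR 1 (by norm_num))
    (by simpa [sub_eq_add_neg] using hR (-1) (by norm_num)) hB hE hΦ
  have hCe : (C ε : ℂ⟦X⟧) ^ 2 = 1 := by rw [← map_pow, he2, map_one]
  -- Multiplied by `ε`, with `ε² = 1`, `h1` becomes the linear relation between `F = B E` and the
  -- Riccati solution `T = O + ε N`.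
  have h2 := wkb_second_order (B * E) (O + C ε * N) (ε * (q ^ 6)⁻¹) (by simp [he0, hq])
    (hR ε he2) (by
      rw [map_mul]
      linear_combination C ε * h1 - 4 * B * E * (O - 1) * hCe)
  constructor
  · rw [hwkb, coeff_C_mul, coeff_zero_eq_constantCoeff_apply, map_mul, hBdef, hEdef]
    have e1 : ∀ f u : ℂ⟦X⟧, constantCoeff u = 0 →
        constantCoeff (f.subst u) = constantCoeff f := by
      intro f u hu
      have h := constantCoeff_subst_eq_zero (R := ℂ) hu (f - C (constantCoeff f)) (by simp)
      rw [subst_sub (HasSubst.of_constantCoeff_zero' hu), subst_C] at h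
      have h' : constantCoeff (f.subst u - (C (constantCoeff f) : ℂ⟦X⟧)) = 0 := h
      rwa [map_sub, constantCoeff_C, sub_eq_zero] at h'
    rw [e1 _ _ hU, e1 _ _ hV]
    simp
  · intro n
    have h := congrArg (coeff n) h2
    rw [← map_ofNat C 48, ← map_ofNat C 36, ← map_ofNat C 5] at h
    simp only [coeff_C_mul, map_add] at h
    have hX : ∀ f : ℂ⟦X⟧, coeff n (X * d⁄dX ℂ f) = n * coeff n f := by
      intro f
      rcases n with _ | n
      · simp
      · rw [coeff_succ_X_mul, coeff_derivative]
        push_cast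
        ring
    rw [hX, hX, coeff_derivative] at h
    rw [hwkb, coeff_C_mul, coeff_C_mul]
    linear_combination q⁻¹ * h

end AiryWKB
end

/-! ### The series `F(1/6, 5/6; 1/2; w)`: convergence, differential equation, algebraicity. -/

noncomputable section
namespace AiryWKB

theorem summable_mul_pow_of_le {a : ℕ → ℂ} {c : ℝ} {k : ℕ}
    (ha : ∀ n, ‖a n‖ ≤ c * ((n + 1 : ℕ) : ℝ) ^ k) {w : ℂ} (hw : ‖w‖ < 1) :
    Summable fun n => a n * w ^ n := by
  obtain ⟨r, hr, hr1⟩ := exists_between hw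
  have hr0 : 0 < r := (norm_nonneg w).trans_lt hr
  have hs := (summable_nat_add_iff 1).2
    (summable_pow_mul_geometric_of_norm_lt_one k (r := r) (by rwa [Real.norm_of_nonneg hr0.le]))
  refine Summable.of_norm_bounded (hs.mul_left (c / r)) fun n => ?_
  rw [norm_mul, norm_pow]
  calc ‖a n‖ * ‖w‖ ^ n ≤ (c * ((n + 1 : ℕ) : ℝ) ^ k) * r ^ n := by
        gcongr
        · exact (norm_nonneg _).trans (ha n)
        · exact ha n
    _ = _ := by
        field_simp
        ring

/-- Termwise differentiation of a power series on the unit disc. -/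
theorem hasDerivAt_tsum_mul_pow {a : ℕ → ℂ} {c : ℝ} {k : ℕ}
    (ha : ∀ n, ‖a n‖ ≤ c * ((n + 1 : ℕ) : ℝ) ^ k) {w : ℂ} (hw : ‖w‖ < 1) :
    HasDerivAt (fun z => ∑' n, a n * z ^ n) (∑' n, ((n + 1) * a (n + 1)) * w ^ n) w := by
  obtain ⟨r, hr, hr1⟩ := exists_between hw
  have hr0 : 0 < r := (norm_nonneg w).trans_lt hr
  have hs := (summable_nat_add_iff 1).2
    (summable_pow_mul_geometric_of_norm_lt_one (k + 1) (r := r)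
      (by rwa [Real.norm_of_nonneg hr0.le]))
  have hc : 0 ≤ c := by simpa using (norm_nonneg _).trans (ha 0)
  have hbound : ∀ (n : ℕ) (y : ℂ), y ∈ Metric.ball (0 : ℂ) r → ‖a n * (n * y ^ (n - 1))‖ ≤
      c / r ^ 2 * (((n + 1 : ℕ) : ℝ) ^ (k + 1) * r ^ (n + 1)) := by
    intro n y hy
    have hy : ‖y‖ ≤ r := (mem_ball_zero_iff.1 hy).le
    rcases n with _ | n
    · simp only [Nat.cast_zero, zero_mul, mul_zero, norm_zero]
      positivity
    · rw [norm_mul, norm_mul, norm_pow, Complex.norm_natCast, Nat.add_sub_cancel]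
      calc ‖a (n + 1)‖ * (((n + 1 : ℕ) : ℝ) * ‖y‖ ^ n)
          ≤ (c * ((n + 1 + 1 : ℕ) : ℝ) ^ k) * (((n + 1 + 1 : ℕ) : ℝ) * r ^ n) := by
            gcongr
            · exact ha (n + 1)
            · omega
        _ = _ := by
            field_simp
            ring
  have h := hasDerivAt_tsum_of_isPreconnected (g := fun n z => a n * z ^ n)
    (g' := fun n z => a n * (n * z ^ (n - 1))) (hs.mul_left (c / r ^ 2)) Metric.isOpen_ball
    (convex_ball (0 : ℂ) r).isPreconnected
    (fun n y _ => (hasDerivAt_pow n y).const_mul (a n)) hbound (Metric.mem_ball_self hr0)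
    (summable_mul_pow_of_le ha (by simp)) (mem_ball_zero_iff.2 hr)
  have hw' : w ∈ Metric.ball (0 : ℂ) r := mem_ball_zero_iff.2 hr
  have hsum : Summable fun n => a n * (n * w ^ (n - 1)) :=
    Summable.of_norm_bounded (hs.mul_left (c / r ^ 2)) fun n => hbound n w hw'
  rw [hsum.tsum_eq_zero_add] at h
  have e : ∑' n, ((n + 1) * a (n + 1)) * w ^ n = a 0 * ((0 : ℕ) * w ^ (0 - 1)) +
      ∑' n : ℕ, a (n + 1) * ((n + 1 : ℕ) * w ^ (n + 1 - 1)) := by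
    simp only [Nat.cast_zero, zero_mul, mul_zero, zero_add, Nat.add_sub_cancel]
    refine tsum_congr fun n => ?_
    push_cast
    ring
  rw [e]
  exact h

/-- The coefficients of the hypergeometric series `F(1/6, 5/6; 1/2; w)`. -/
def hypCoeff : ℕ → ℂ
  | 0 => 1
  | n + 1 => hypCoeff n * ((36 * n ^ 2 + 36 * n + 5) / (36 * ((n + 1) * (n + 1 / 2))))

theorem natCast_add_half_ne_zero (n : ℕ) : (n : ℂ) + 1 / 2 ≠ 0 := by
  have : (2 * n + 1 : ℂ) ≠ 0 := by exact_mod_cast Nat.succ_ne_zero (2 * n)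
  intro h
  apply this
  linear_combination 2 * h

theorem hypCoeff_succ (n : ℕ) : 36 * ((n + 1) * (n + 1 / 2)) * hypCoeff (n + 1) =
    (36 * n ^ 2 + 36 * n + 5) * hypCoeff n := by
  have h1 : (n : ℂ) + 1 ≠ 0 := Nat.cast_add_one_ne_zero n
  have h2 := natCast_add_half_ne_zero n
  rw [hypCoeff]
  generalize (n : ℂ) + 1 / 2 = m at *
  field_simp

/-- Consecutive coefficients have ratio at most 1, since `36n² + 36n + 5 ≤ 36n² + 54n + 18`. -/
theorem norm_hypCoeff_le (n : ℕ) : ‖hypCoeff n‖ ≤ 1 := by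
  induction n with
  | zero => simp [hypCoeff]
  | succ n ih =>
    rw [hypCoeff, norm_mul]
    refine mul_le_one₀ ih (norm_nonneg _) ?_
    have : ((36 * n ^ 2 + 36 * n + 5) / (36 * ((n + 1) * (n + 1 / 2))) : ℂ) =
        (((36 * n ^ 2 + 36 * n + 5) / (36 * ((n + 1) * (n + 1 / 2))) : ℝ) : ℂ) := by
      push_cast
      rfl
    rw [this, Complex.norm_real, Real.norm_of_nonneg (by positivity)]
    rw [div_le_one (by positivity)]
    have : (0 : ℝ) ≤ n := n.cast_nonneg
    nlinarith

/-- The hypergeometric function `F(1/6, 5/6; 1/2; w)` on the unit disc. -/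
def hypFun (w : ℂ) : ℂ := ∑' n, hypCoeff n * w ^ n

/-- The derivative of `hypFun`. -/
def hypFun' (w : ℂ) : ℂ := ∑' n, ((n + 1) * hypCoeff (n + 1)) * w ^ n

/-- The second derivative of `hypFun`. -/
def hypFun'' (w : ℂ) : ℂ :=
  ∑' n, ((n + 1) * (((n + 1 : ℕ) + 1) * hypCoeff (n + 1 + 1))) * w ^ n

theorem norm_hypCoeff_le' (n : ℕ) : ‖hypCoeff n‖ ≤ 1 * ((n + 1 : ℕ) : ℝ) ^ 0 := by
  simpa using norm_hypCoeff_le n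

theorem norm_deriv_hypCoeff_le (n : ℕ) :
    ‖((n + 1) * hypCoeff (n + 1) : ℂ)‖ ≤ 1 * ((n + 1 : ℕ) : ℝ) ^ 1 := by
  have h1 : ((n : ℂ) + 1) = ((n + 1 : ℕ) : ℂ) := by push_cast; rfl
  rw [norm_mul, h1, Complex.norm_natCast, one_mul, pow_one]
  exact mul_le_of_le_one_right (Nat.cast_nonneg _) (norm_hypCoeff_le _)

theorem norm_deriv_deriv_hypCoeff_le (n : ℕ) :
    ‖((n + 1) * (((n + 1 : ℕ) + 1) * hypCoeff (n + 1 + 1)) : ℂ)‖ ≤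
      2 * ((n + 1 : ℕ) : ℝ) ^ 2 := by
  have h := norm_deriv_hypCoeff_le (n + 1)
  have h1 : ((n : ℂ) + 1) = ((n + 1 : ℕ) : ℂ) := by push_cast; rfl
  rw [norm_mul, h1, Complex.norm_natCast]
  have h0 : (0 : ℝ) ≤ n := n.cast_nonneg
  push_cast at h ⊢
  nlinarith

theorem hasDerivAt_hypFun {w : ℂ} (hw : ‖w‖ < 1) : HasDerivAt hypFun (hypFun' w) w :=
  hasDerivAt_tsum_mul_pow norm_hypCoeff_le' hw

theorem hasDerivAt_hypFun' {w : ℂ} (hw : ‖w‖ < 1) : HasDerivAt hypFun' (hypFun'' w) w :=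
  hasDerivAt_tsum_mul_pow norm_deriv_hypCoeff_le hw

theorem hypFun_zero : hypFun 0 = 1 := by
  rw [hypFun, tsum_eq_single 0]
  · simp [hypCoeff]
  · intro n hn
    simp [hn]

/-- The hypergeometric differential equation. -/
theorem hypFun_ode {w : ℂ} (hw : ‖w‖ < 1) :
    36 * (w * (1 - w) * hypFun'' w + (1 / 2 - 2 * w) * hypFun' w) = 5 * hypFun w := by
  have s0 := (summable_mul_pow_of_le norm_hypCoeff_le' hw).hasSum
  have s1 := (summable_mul_pow_of_le norm_deriv_hypCoeff_le hw).hasSum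
  have s2 := (summable_mul_pow_of_le norm_deriv_deriv_hypCoeff_le hw).hasSum
  rw [← hypFun] at s0
  rw [← hypFun'] at s1
  rw [← hypFun''] at s2
  -- Multiplication by `w` shifts the index by one; the additional term at `n = 0` carries the
  -- factor `n`. The same holds for `w2` and `w3`.
  have w1 : HasSum (fun n : ℕ => n * hypCoeff n * w ^ n) (w * hypFun' w) := by
    have := s1.mul_left w
    rw [← hasSum_nat_add_iff' 1]
    simp only [Finset.range_one, Finset.sum_singleton, Nat.cast_zero, zero_mul, sub_zero]
    refine this.congr_fun fun n => ?_
    push_cast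
    ring
  have w2 : HasSum (fun n : ℕ => n * ((n + 1) * hypCoeff (n + 1)) * w ^ n) (w * hypFun'' w) := by
    have := s2.mul_left w
    rw [← hasSum_nat_add_iff' 1]
    simp only [Finset.range_one, Finset.sum_singleton, Nat.cast_zero, zero_mul, sub_zero]
    refine this.congr_fun fun n => ?_
    push_cast
    ring
  have w3 : HasSum (fun n : ℕ => n * (n - 1) * hypCoeff n * w ^ n) (w * (w * hypFun'' w)) := by
    have := w2.mul_left w
    rw [← hasSum_nat_add_iff' 1]
    simp only [Finset.range_one, Finset.sum_singleton, Nat.cast_zero, zero_mul, sub_zero]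
    refine this.congr_fun fun n => ?_
    push_cast
    ring
  have h := ((((w2.sub w3).add ((s1.mul_left (1 / 2)).sub (w1.mul_left 2))).mul_left 36).sub
    (s0.mul_left 5))
  have hz : HasSum (fun _ : ℕ => (0 : ℂ)) 0 := hasSum_zero
  have := h.unique (hz.congr_fun fun n => ?_)
  · linear_combination this
  · linear_combination w ^ n * hypCoeff_succ n

theorem analyticOnNhd_hypFun : AnalyticOnNhd ℂ hypFun (Metric.ball 0 1) :=
  DifferentiableOn.analyticOnNhd (fun _ hw =>
    (hasDerivAt_hypFun (mem_ball_zero_iff.1 hw)).differentiableAt.differentiableWithinAt)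
    Metric.isOpen_ball

/-- The trigonometric form of the hypergeometric function. -/
theorem eventually_hypFun_sin_sq : ∀ᶠ u in nhds (0 : ℂ),
    Complex.cos u * hypFun (Complex.sin u ^ 2) = Complex.cos (2 / 3 * u) := by
  have hcont : ContinuousAt (fun u : ℂ => Complex.sin u ^ 2) 0 := by fun_prop
  have hnhds : (fun u : ℂ => Complex.sin u ^ 2) ⁻¹' Metric.ball 0 1 ∈ nhds (0 : ℂ) :=
    hcont (Metric.isOpen_ball.mem_nhds (by simp))
  obtain ⟨r, hr, hball⟩ := Metric.mem_nhds_iff.1 hnhds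
  have hw : ∀ u ∈ Metric.ball (0 : ℂ) r, ‖Complex.sin u ^ 2‖ < 1 := fun u hu =>
    mem_ball_zero_iff.1 (hball hu)
  set h : ℂ → ℂ := fun u => Complex.cos u * hypFun (Complex.sin u ^ 2) with hh
  set h' : ℂ → ℂ := fun u => -Complex.sin u * hypFun (Complex.sin u ^ 2) +
    2 * Complex.sin u * Complex.cos u ^ 2 * hypFun' (Complex.sin u ^ 2) with hh'
  have hsin2 : ∀ u, HasDerivAt (fun u : ℂ => Complex.sin u ^ 2)
      (2 * Complex.sin u * Complex.cos u) u := fun u => by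
    simpa using (Complex.hasDerivAt_sin u).fun_pow 2
  have hcos2 : ∀ u, HasDerivAt (fun u : ℂ => Complex.cos u ^ 2)
      (-(2 * Complex.cos u * Complex.sin u)) u := fun u => by
    simpa using (Complex.hasDerivAt_cos u).fun_pow 2
  have d0 : ∀ u ∈ Metric.ball (0 : ℂ) r, HasDerivAt (fun u => hypFun (Complex.sin u ^ 2))
      (hypFun' (Complex.sin u ^ 2) * (2 * Complex.sin u * Complex.cos u)) u := fun u hu =>
    HasDerivAt.comp (h₂ := hypFun) u (hasDerivAt_hypFun (hw u hu)) (hsin2 u)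
  have d1 : ∀ u ∈ Metric.ball (0 : ℂ) r, HasDerivAt (fun u => hypFun' (Complex.sin u ^ 2))
      (hypFun'' (Complex.sin u ^ 2) * (2 * Complex.sin u * Complex.cos u)) u := fun u hu =>
    HasDerivAt.comp (h₂ := hypFun') u (hasDerivAt_hypFun' (hw u hu)) (hsin2 u)
  have dh : ∀ u ∈ Metric.ball (0 : ℂ) r, HasDerivAt h (h' u) u := by
    intro u hu
    refine ((Complex.hasDerivAt_cos u).fun_mul (d0 u hu)).congr_deriv ?_
    simp only [hh']
    ring
  -- In the variable `w = sin² u`, the hypergeometric equation becomes `h'' = -(4/9) h`.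
  have dh' : ∀ u ∈ Metric.ball (0 : ℂ) r, HasDerivAt h' (-(4 / 9) * h u) u := by
    intro u hu
    refine (((Complex.hasDerivAt_sin u).fun_neg.fun_mul (d0 u hu)).fun_add
      ((((Complex.hasDerivAt_sin u).const_mul 2).fun_mul (hcos2 u)).fun_mul
        (d1 u hu))).congr_deriv ?_
    simp only [hh]
    have ho := hypFun_ode (hw u hu)
    have hs := Complex.sin_sq_add_cos_sq u
    generalize hypFun (Complex.sin u ^ 2) = F at *
    generalize hypFun' (Complex.sin u ^ 2) = F' at *
    generalize hypFun'' (Complex.sin u ^ 2) = F'' at *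
    generalize Complex.sin u = s at *
    generalize Complex.cos u = c at *
    linear_combination c / 9 * ho + (2 * c * F' + 4 * s ^ 2 * c * F'') * hs
  have hc : ∀ u, HasDerivAt (fun u : ℂ => Complex.cos (2 / 3 * u))
      (-Complex.sin (2 / 3 * u) * (2 / 3)) u := fun u => by
    simpa using ((hasDerivAt_id u).const_mul (2 / 3 : ℂ)).ccos
  have hs : ∀ u, HasDerivAt (fun u : ℂ => Complex.sin (2 / 3 * u))
      (Complex.cos (2 / 3 * u) * (2 / 3)) u := fun u => by
    simpa using ((hasDerivAt_id u).const_mul (2 / 3 : ℂ)).csin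
  have hconst : ∀ f : ℂ → ℂ, (∀ u ∈ Metric.ball (0 : ℂ) r, HasDerivAt f 0 u) →
      ∀ u ∈ Metric.ball (0 : ℂ) r, f u = f 0 := fun f hf u hu =>
    Metric.isOpen_ball.is_const_of_deriv_eq_zero (convex_ball (0 : ℂ) r).isPreconnected
      (fun v hv => (hf v hv).differentiableAt.differentiableWithinAt)
      (fun v hv => (hf v hv).deriv) hu (Metric.mem_ball_self hr)
  have h0 : h 0 = 1 := by simp [hh, hypFun_zero]
  have h0' : h' 0 = 0 := by simp [hh']
  -- Uniqueness for the oscillator: rotating the vector `(h, (3/2) h')` by the angle `2u/3` makes it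
  -- constant.
  have k1 := hconst (fun u => h u * Complex.cos (2 / 3 * u) -
    3 / 2 * (h' u * Complex.sin (2 / 3 * u))) fun u hu =>
      (((dh u hu).fun_mul (hc u)).fun_sub (((dh' u hu).fun_mul (hs u)).const_mul (3 / 2))).congr_deriv
        (by ring)
  have k2 := hconst (fun u => h u * Complex.sin (2 / 3 * u) +
    3 / 2 * (h' u * Complex.cos (2 / 3 * u))) fun u hu =>
      (((dh u hu).fun_mul (hs u)).fun_add (((dh' u hu).fun_mul (hc u)).const_mul (3 / 2))).congr_deriv
        (by ring)
  filter_upwards [Metric.ball_mem_nhds (0 : ℂ) hr] with u hu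
  have e1 := k1 u hu
  have e2 := k2 u hu
  simp only [h0, h0', mul_zero, Complex.cos_zero, Complex.sin_zero, mul_one, sub_zero, add_zero]
    at e1 e2
  change h u = _
  linear_combination Complex.cos (2 / 3 * u) * e1 + Complex.sin (2 / 3 * u) * e2 -
    h u * Complex.sin_sq_add_cos_sq (2 / 3 * u)

/-- The hypergeometric function is algebraic. -/
theorem hypFun_algebraic {w : ℂ} (hw : ‖w‖ < 1) :
    (1 - w) * hypFun w ^ 2 * (4 * ((1 - w) * hypFun w ^ 2) - 3) ^ 2 = (1 - 2 * w) ^ 2 := by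
  -- Open mapping: every `w` near 0 is `sin² u` with `u` near 0, so the relation need only be
  -- checked in `u`.
  have hsurj : nhds (0 : ℂ) ≤ Filter.map (fun u : ℂ => Complex.sin u ^ 2) (nhds 0) := by
    have han : AnalyticAt ℂ (fun u : ℂ => Complex.sin u ^ 2) 0 := by fun_prop
    rcases han.eventually_constant_or_nhds_le_map_nhds with h | h
    · exfalso
      have h1 : AnalyticOnNhd ℂ (fun u : ℂ => Complex.sin u ^ 2) Set.univ := fun u _ => by fun_prop
      have h2 := h1.eqOn_of_preconnected_of_eventuallyEq analyticOnNhd_const isPreconnected_univ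
        (Set.mem_univ 0) h (Set.mem_univ (Real.pi / 2 : ℂ))
      simp [Complex.sin_pi_div_two] at h2
    · simpa using h
  have hnear : ∀ᶠ w in nhds (0 : ℂ), (1 - w) * hypFun w ^ 2 *
      (4 * ((1 - w) * hypFun w ^ 2) - 3) ^ 2 = (1 - 2 * w) ^ 2 := by
    refine hsurj (Filter.mem_map.2 ?_)
    filter_upwards [eventually_hypFun_sin_sq] with u hu
    have hJ : (1 - Complex.sin u ^ 2) * hypFun (Complex.sin u ^ 2) ^ 2 =
        Complex.cos (2 / 3 * u) ^ 2 := by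
      rw [← hu, ← Complex.cos_sq']
      ring
    have h3 : 1 - 2 * Complex.sin u ^ 2 =
        4 * Complex.cos (2 / 3 * u) ^ 3 - 3 * Complex.cos (2 / 3 * u) := by
      rw [← Complex.cos_three_mul, show 3 * (2 / 3 * u) = 2 * u by ring, Complex.cos_two_mul,
        Complex.cos_sq']
      ring
    change (1 - Complex.sin u ^ 2) * hypFun (Complex.sin u ^ 2) ^ 2 *
      (4 * ((1 - Complex.sin u ^ 2) * hypFun (Complex.sin u ^ 2) ^ 2) - 3) ^ 2 =
      (1 - 2 * Complex.sin u ^ 2) ^ 2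
    rw [hJ, h3]
    ring
  have han : AnalyticOnNhd ℂ (fun w => (1 - w) * hypFun w ^ 2 *
      (4 * ((1 - w) * hypFun w ^ 2) - 3) ^ 2) (Metric.ball 0 1) := by
    have h1 : AnalyticOnNhd ℂ (fun w : ℂ => 1 - w) (Metric.ball 0 1) := fun w _ => by fun_prop
    have h2 := h1.mul (analyticOnNhd_hypFun.pow 2)
    exact h2.mul (((analyticOnNhd_const.mul h2).sub analyticOnNhd_const).pow 2)
  have han2 : AnalyticOnNhd ℂ (fun w : ℂ => (1 - 2 * w) ^ 2) (Metric.ball 0 1) :=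
    fun w _ => by fun_prop
  exact han.eqOn_of_preconnected_of_eventuallyEq han2 (convex_ball (0 : ℂ) 1).isPreconnected
    (Metric.mem_ball_self one_pos) hnear (mem_ball_zero_iff.2 hw)

/-- The terms of the Borel transform are those of a hypergeometric series. -/
theorem borelTerm_eq (ε q σ : ℂ) (hε : ε = 1 ∨ ε = -1) (hq : q ≠ 0) (hσ : σ ≠ 0) (n : ℕ) :
    borelTerm ε q σ n = q⁻¹ * σ⁻¹ * (Complex.Gamma (1 / 2))⁻¹ *
      (hypCoeff n * (3 / 4 * ε * σ ^ 2 / q ^ 6) ^ n) := by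
  obtain ⟨h0, hrec⟩ := coeff_wkbSeries ε q hε hq
  have hG : Complex.Gamma (1 / 2) ≠ 0 := Complex.Gamma_ne_zero_of_re_pos (by norm_num)
  induction n with
  | zero =>
    simp [borelTerm, h0, hypCoeff]
    ring
  | succ n ih =>
    have h1 : (n : ℂ) + 1 ≠ 0 := Nat.cast_add_one_ne_zero n
    have h2 := natCast_add_half_ne_zero n
    have hGn : Complex.Gamma ((n : ℂ) + 1 / 2) ≠ 0 :=
      Complex.Gamma_ne_zero_of_re_pos (by simp; positivity)
    have hG1 : Complex.Gamma (((n + 1 : ℕ) : ℂ) + 1 / 2) =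
        ((n : ℂ) + 1 / 2) * Complex.Gamma ((n : ℂ) + 1 / 2) := by
      rw [← Complex.Gamma_add_one _ h2]
      congr 1
      push_cast
      ring
    have hz : σ ^ (2 * ((n + 1 : ℕ) : ℤ) - 1) = σ ^ (2 * (n : ℤ) - 1) * σ ^ 2 := by
      rw [show (2 * ((n + 1 : ℕ) : ℤ) - 1) = (2 * (n : ℤ) - 1) + 2 by push_cast; ring,
        zpow_add₀ hσ]
      rfl
    have hc : PowerSeries.coeff (n + 1) (wkbSeries ε q) = PowerSeries.coeff n (wkbSeries ε q) *
        (ε * (q ^ 6)⁻¹ * (36 * n ^ 2 + 36 * n + 5) / (48 * (n + 1))) := by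
      field_simp
      have := hrec n
      field_simp at this
      linear_combination this
    -- The Gamma quotient supplies the missing factor `n + 1/2`; the 3/4 in the variable is 36/48.
    have step : borelTerm ε q σ (n + 1) = borelTerm ε q σ n *
        ((ε * (q ^ 6)⁻¹ * (36 * n ^ 2 + 36 * n + 5) / (48 * (n + 1))) * σ ^ 2 / (n + 1 / 2)) := by
      rw [borelTerm, borelTerm, hG1, hz, hc]
      generalize (n : ℂ) + 1 / 2 = m at *
      field_simp
    rw [step, ih, hypCoeff, pow_succ (3 / 4 * ε * σ ^ 2 / q ^ 6) n]
    generalize (n : ℂ) + 1 / 2 = m at *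
    generalize (3 / 4 * ε * σ ^ 2 / q ^ 6) ^ n = W
    field_simp
    ring

end AiryWKB
end

/-! ### The differential system for the branches of `g`. -/

noncomputable section
namespace AiryWKB

open Filter Topology

/-- Implicit differentiation of `d G³ + 3 e G + 1 = 0`. -/
theorem cubic_deriv {d d' d'' e G : ℂ → ℂ} {e' z₀ : ℂ} (hd : ∀ z, HasDerivAt d (d' z) z)
    (hd' : ∀ z, HasDerivAt d' (d'' z) z) (he : ∀ z, HasDerivAt e e' z) (hG : AnalyticAt ℂ G z₀)
    (h : ∀ᶠ z in 𝓝 z₀, d z * G z ^ 3 + 3 * e z * G z + 1 = 0) :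
    d' z₀ * G z₀ ^ 3 + 3 * d z₀ * G z₀ ^ 2 * deriv G z₀ + 3 * e' * G z₀ +
        3 * e z₀ * deriv G z₀ = 0 ∧
      d'' z₀ * G z₀ ^ 3 + 6 * d' z₀ * G z₀ ^ 2 * deriv G z₀ + 6 * d z₀ * G z₀ * deriv G z₀ ^ 2 +
        3 * d z₀ * G z₀ ^ 2 * iteratedDeriv 2 G z₀ + 6 * e' * deriv G z₀ +
        3 * e z₀ * iteratedDeriv 2 G z₀ = 0 := by
  have key : ∀ (f : ℂ → ℂ) (f' z : ℂ), (∀ᶠ w in 𝓝 z, f w = 0) → HasDerivAt f f' z → f' = 0 := by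
    intro f f' z h0 hf
    have h0' : f =ᶠ[𝓝 z] fun _ => 0 := h0
    exact (h0'.hasDerivAt_iff.1 hf).unique (hasDerivAt_const z 0)
  have h1 : ∀ᶠ z in 𝓝 z₀, d' z * G z ^ 3 + 3 * d z * G z ^ 2 * deriv G z + 3 * e' * G z +
      3 * e z * deriv G z = 0 := by
    filter_upwards [h.eventually_nhds, hG.eventually_analyticAt] with z hz hGz
    have hGd := hGz.differentiableAt.hasDerivAt
    refine key _ _ z hz (((((hd z).fun_mul (hGd.fun_pow 3)).fun_add
      (((he z).const_mul 3).fun_mul hGd)).add_const 1).congr_deriv ?_)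
    norm_num
    ring
  refine ⟨h1.self_of_nhds, ?_⟩
  have hGd := hG.differentiableAt.hasDerivAt
  have hGd' := hG.deriv.differentiableAt.hasDerivAt
  have h2 : iteratedDeriv 2 G z₀ = deriv (deriv G) z₀ := by
    rw [iteratedDeriv_succ, iteratedDeriv_one]
  rw [h2]
  refine key _ _ z₀ h1 ((((((hd' z₀).fun_mul (hGd.fun_pow 3)).fun_add
    ((((hd z₀).const_mul 3).fun_mul (hGd.fun_pow 2)).fun_mul hGd')).fun_add
    (hGd.const_mul (3 * e'))).fun_add (((he z₀).const_mul 3).fun_mul hGd')).congr_deriv ?_)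
  norm_num
  ring

/-- The system for `g`, in terms of its implicit derivatives. -/
theorem system_of_implicit {x y g gx gxx gy gyy : ℂ} (hy : y ≠ 0)
    (h : (9 * y ^ 2 - 4 * x ^ 3) * g ^ 3 + 3 * x * g + 1 = 0)
    (hx1 : -12 * x ^ 2 * g ^ 3 + 3 * (9 * y ^ 2 - 4 * x ^ 3) * g ^ 2 * gx + 3 * g + 3 * x * gx = 0)
    (hx2 : -24 * x * g ^ 3 + 6 * (-12 * x ^ 2) * g ^ 2 * gx +
      6 * (9 * y ^ 2 - 4 * x ^ 3) * g * gx ^ 2 +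
      3 * (9 * y ^ 2 - 4 * x ^ 3) * g ^ 2 * gxx + 6 * gx + 3 * x * gxx = 0)
    (hy1 : 18 * y * g ^ 3 + 3 * (9 * y ^ 2 - 4 * x ^ 3) * g ^ 2 * gy + 3 * x * gy = 0)
    (hy2 : 18 * g ^ 3 + 6 * (18 * y) * g ^ 2 * gy + 6 * (9 * y ^ 2 - 4 * x ^ 3) * g * gy ^ 2 +
      3 * (9 * y ^ 2 - 4 * x ^ 3) * g ^ 2 * gyy + 3 * x * gyy = 0) :
    -gxx + x * gyy = 0 ∧ 2 * x * gx + 3 * y * gy + 2 * g = 0 := by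
  have hg : g ≠ 0 := by
    rintro rfl
    simp at h
  have hyg : 9 * y ^ 2 * g ^ 3 = (x * g - 1) * (1 + 2 * (x * g)) ^ 2 := by
    linear_combination h
  -- By the cubic, `-3 (1 + 2xg)` is `g` times the `g`-derivative of the cubic, so this is the
  -- condition for implicit differentiation. By `hyg` it can fail only where `y = 0`.
  have hL : 1 + 2 * (x * g) ≠ 0 := by
    intro h0
    rw [h0] at hyg
    simp [hy, hg] at hyg
  have hX : gx = g ^ 2 * (1 - 2 * (x * g)) := by
    apply mul_left_cancel₀ hL
    linear_combination -g / 3 * hx1 + gx * h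
  have hY : (1 + 2 * (x * g)) * gy = 6 * y * g ^ 4 := by
    linear_combination -g / 3 * hy1 + gy * h
  have hXX : gxx = 2 * (x * g) * g ^ 3 * (6 * (x * g) - 5) := by
    apply mul_left_cancel₀ hL
    rw [hX] at hx2
    linear_combination -g / 3 * hx2 + (gxx + 2 * g ^ 3 * (1 - 2 * (x * g)) ^ 2) * h
  have hYY : gyy = 2 * g ^ 4 * (6 * (x * g) - 5) := by
    apply mul_left_cancel₀ (pow_ne_zero 3 hL)
    linear_combination (1 + 2 * (x * g)) ^ 2 * (-g / 3 * hy2 + gyy * h) +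
      (36 * y * g ^ 3 * (1 + 2 * (x * g)) + 2 * (9 * y ^ 2 - 4 * x ^ 3) * g ^ 2 *
        ((1 + 2 * (x * g)) * gy + 6 * y * g ^ 4)) * hY + 72 * y ^ 2 * g ^ 7 * h +
      (24 * g ^ 4 * (1 + 2 * (x * g)) - 8 * g ^ 4 * (1 + 3 * (x * g))) * hyg
  constructor
  · rw [hXX, hYY]
    ring
  · apply mul_left_cancel₀ hL
    rw [hX]
    linear_combination 3 * y * hY + 2 * g * hyg

/-- The points outside the discriminant locus are dense. -/
theorem frequently_ne_zero (p : ℂ × ℂ) :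
    ∃ᶠ z in 𝓝 p, z.2 ≠ 0 ∧ 9 * z.2 ^ 2 - 4 * z.1 ^ 3 ≠ 0 := by
  intro h
  have han : AnalyticOnNhd ℂ (fun z : ℂ × ℂ => z.2 * (9 * z.2 ^ 2 - 4 * z.1 ^ 3)) Set.univ :=
    fun z _ =>
    analyticAt_snd.mul ((analyticAt_const.mul (analyticAt_snd.pow 2)).sub
      (analyticAt_const.mul (analyticAt_fst.pow 3)))
  have h0 : (fun z : ℂ × ℂ => z.2 * (9 * z.2 ^ 2 - 4 * z.1 ^ 3)) =ᶠ[𝓝 p] 0 := by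
    filter_upwards [h] with z hz
    by_contra hne
    exact hz ⟨left_ne_zero_of_mul hne, right_ne_zero_of_mul hne⟩
  have := han.eqOn_zero_of_preconnected_of_eventuallyEq_zero isPreconnected_univ
    (Set.mem_univ p) h0 (Set.mem_univ ((0, 1) : ℂ × ℂ))
  norm_num at this

theorem eq_zero_of_continuousAt {f : ℂ × ℂ → ℂ} {p : ℂ × ℂ} (hf : ContinuousAt f p)
    (h : ∃ᶠ z in 𝓝 p, f z = 0) : f p = 0 := by
  by_contra hne
  exact h (hf.eventually_ne hne)

/-- The partial derivative with respect to `x` of an analytic function. -/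
theorem analyticOnNhd_deriv_fst {W : Set (ℂ × ℂ)} (hW : IsOpen W) {u : ℂ × ℂ → ℂ}
    (hu : AnalyticOnNhd ℂ u W) : AnalyticOnNhd ℂ (fun p => deriv (fun x => u (x, p.2)) p.1) W := by
  have h : AnalyticOnNhd ℂ (fun p => fderiv ℂ u p (1, 0)) W :=
    (ContinuousLinearMap.apply ℂ ℂ ((1, 0) : ℂ × ℂ)).comp_analyticOnNhd hu.fderiv
  refine h.congr hW fun p hp => ?_
  have h2 : HasDerivAt (fun x : ℂ => (x, p.2)) (1, 0) p.1 :=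
    (hasDerivAt_id p.1).prodMk (hasDerivAt_const p.1 p.2)
  have h1 : HasFDerivAt u (fderiv ℂ u p) (p.1, p.2) := (hu p hp).differentiableAt.hasFDerivAt
  exact (h1.comp_hasDerivAt p.1 h2).deriv.symm

/-- The partial derivative with respect to `y` of an analytic function. -/
theorem analyticOnNhd_deriv_snd {W : Set (ℂ × ℂ)} (hW : IsOpen W) {u : ℂ × ℂ → ℂ}
    (hu : AnalyticOnNhd ℂ u W) : AnalyticOnNhd ℂ (fun p => deriv (fun y => u (p.1, y)) p.2) W := by
  have h : AnalyticOnNhd ℂ (fun p => fderiv ℂ u p (0, 1)) W :=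
    (ContinuousLinearMap.apply ℂ ℂ ((0, 1) : ℂ × ℂ)).comp_analyticOnNhd hu.fderiv
  refine h.congr hW fun p hp => ?_
  have h2 : HasDerivAt (fun y : ℂ => (p.1, y)) (0, 1) p.2 :=
    (hasDerivAt_const p.2 p.1).prodMk (hasDerivAt_id p.2)
  have h1 : HasFDerivAt u (fderiv ℂ u p) (p.1, p.2) := (hu p hp).differentiableAt.hasFDerivAt
  exact (h1.comp_hasDerivAt p.2 h2).deriv.symm

/-- An analytic function that solves the system on a dense set solves it everywhere. -/
theorem solvesSystem_of_frequently {W : Set (ℂ × ℂ)} (hW : IsOpen W) {u : ℂ × ℂ → ℂ}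
    (hu : AnalyticOnNhd ℂ u W) (h : ∀ p ∈ W, ∃ᶠ z in 𝓝 p, SolvesSystem {z} u) :
    SolvesSystem W u := by
  have hx := analyticOnNhd_deriv_fst hW hu
  have hy := analyticOnNhd_deriv_snd hW hu
  have hxx := analyticOnNhd_deriv_fst hW hx
  have hyy := analyticOnNhd_deriv_snd hW hy
  intro p hp
  have e2 : ∀ f : ℂ → ℂ, iteratedDeriv 2 f = deriv (deriv f) := fun f => by
    rw [iteratedDeriv_succ, iteratedDeriv_one]
  constructor
  · refine eq_zero_of_continuousAt (f := fun p => -iteratedDeriv 2 (fun x => u (x, p.2)) p.1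
        + p.1 * iteratedDeriv 2 (fun y => u (p.1, y)) p.2) ?_
      ((h p hp).mono fun z hz => (hz z rfl).1)
    simp only [e2]
    exact (hxx p hp).continuousAt.neg.add (continuousAt_fst.mul (hyy p hp).continuousAt)
  · refine eq_zero_of_continuousAt (f := fun p => 2 * p.1 * deriv (fun x => u (x, p.2)) p.1
        + 3 * p.2 * deriv (fun y => u (p.1, y)) p.2 + 2 * u p) ?_
      ((h p hp).mono fun z hz => (hz z rfl).2)
    exact (((continuousAt_const.mul continuousAt_fst).mul (hx p hp).continuousAt).add
      ((continuousAt_const.mul continuousAt_snd).mul (hy p hp).continuousAt)).add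
      (continuousAt_const.mul (hu p hp).continuousAt)

/-- The branches of the algebraic function `g` solve the system. -/
theorem IsCubicBranch.solvesSystem {W : Set (ℂ × ℂ)} {g : ℂ × ℂ → ℂ} (hW : IsOpen W)
    (hg : IsCubicBranch W g) : SolvesSystem W g := by
  refine solvesSystem_of_frequently hW hg.1 fun p hp => ?_
  -- `system_of_implicit` needs `y ≠ 0`; the remaining points follow by continuity.
  refine ((frequently_ne_zero p).and_eventually (hW.mem_nhds hp)).mono ?_
  rintro ⟨x, y⟩ ⟨⟨hy, -⟩, hz⟩ _ rfl
  have hnhds := hW.mem_nhds hz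
  have hgx : AnalyticAt ℂ (fun t => g (t, y)) x := (hg.1 _ hz).curry_left
  have hgy : AnalyticAt ℂ (fun t => g (x, t)) y := (hg.1 _ hz).curry_right
  have hx0 : ∀ᶠ t in 𝓝 x, (9 * y ^ 2 - 4 * t ^ 3) * g (t, y) ^ 3 + 3 * t * g (t, y) + 1 = 0 := by
    have hc : ContinuousAt (fun t : ℂ => (t, y)) x := by fun_prop
    exact (hc.eventually hnhds).mono fun t ht => hg.2 (t, y) ht
  have hy0 : ∀ᶠ t in 𝓝 y, (9 * t ^ 2 - 4 * x ^ 3) * g (x, t) ^ 3 + 3 * x * g (x, t) + 1 = 0 := by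
    have hc : ContinuousAt (fun t : ℂ => (x, t)) y := by fun_prop
    exact (hc.eventually hnhds).mono fun t ht => hg.2 (x, t) ht
  obtain ⟨x1, x2⟩ := cubic_deriv (d := fun t => 9 * y ^ 2 - 4 * t ^ 3)
    (d' := fun t => -12 * t ^ 2) (d'' := fun t => -24 * t) (e := fun t => t) (e' := 1)
    (fun z => (((hasDerivAt_pow 3 z).const_mul 4).const_sub (9 * y ^ 2)).congr_deriv
      (by norm_num; ring))
    (fun z => ((hasDerivAt_pow 2 z).const_mul (-12)).congr_deriv (by norm_num; ring))
    (fun z => hasDerivAt_id z) hgx hx0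
  obtain ⟨y1, y2⟩ := cubic_deriv (d := fun t => 9 * t ^ 2 - 4 * x ^ 3)
    (d' := fun t => 18 * t) (d'' := fun _ => 18) (e := fun _ => x) (e' := 0)
    (fun z => (((hasDerivAt_pow 2 z).const_mul 9).sub_const (4 * x ^ 3)).congr_deriv
      (by norm_num; ring))
    (fun z => ((hasDerivAt_id z).const_mul 18).congr_deriv (by norm_num))
    (fun z => hasDerivAt_const z x) hgy hy0
  simp only [mul_one, mul_zero, zero_mul, add_zero] at x1 x2 y1 y2
  exact system_of_implicit hy (hg.2 _ hz) x1 x2 y1 y2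

/-- Linear combinations of solutions are solutions. -/
theorem SolvesSystem.linear_comb {W : Set (ℂ × ℂ)} {u v : ℂ × ℂ → ℂ}
    (hu : AnalyticOnNhd ℂ u W) (hv : AnalyticOnNhd ℂ v W) (su : SolvesSystem W u)
    (sv : SolvesSystem W v) (a b : ℂ) : SolvesSystem W fun p => a * u p + b * v p := by
  rintro ⟨x, y⟩ hp
  obtain ⟨u1, u2⟩ := su _ hp
  obtain ⟨v1, v2⟩ := sv _ hp
  have ux : AnalyticAt ℂ (fun t => u (t, y)) x := (hu _ hp).curry_left
  have uy : AnalyticAt ℂ (fun t => u (x, t)) y := (hu _ hp).curry_right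
  have vx : AnalyticAt ℂ (fun t => v (t, y)) x := (hv _ hp).curry_left
  have vy : AnalyticAt ℂ (fun t => v (x, t)) y := (hv _ hp).curry_right
  have h1 : ∀ {f g : ℂ → ℂ} {z : ℂ}, AnalyticAt ℂ f z → AnalyticAt ℂ g z →
      deriv (fun z => a * f z + b * g z) z = a * deriv f z + b * deriv g z := fun hf hg =>
    ((hf.differentiableAt.hasDerivAt.const_mul a).add
      (hg.differentiableAt.hasDerivAt.const_mul b)).deriv
  have h2 : ∀ {f g : ℂ → ℂ} {z : ℂ}, AnalyticAt ℂ f z → AnalyticAt ℂ g z →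
      iteratedDeriv 2 (fun z => a * f z + b * g z) z =
        a * iteratedDeriv 2 f z + b * iteratedDeriv 2 g z := by
    intro f g z hf hg
    simp only [iteratedDeriv_succ, iteratedDeriv_zero]
    have : deriv (fun z => a * f z + b * g z) =ᶠ[𝓝 z] fun z => a * deriv f z + b * deriv g z := by
      filter_upwards [hf.eventually_analyticAt, hg.eventually_analyticAt] with w h3 h4
      exact h1 h3 h4
    rw [this.deriv_eq, h1 hf.deriv hg.deriv]
  simp only at u1 u2 v1 v2 ⊢
  rw [h1 ux vx, h1 uy vy, h2 ux vx, h2 uy vy]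
  constructor
  · linear_combination a * u1 + b * v1
  · linear_combination a * u2 + b * v2

/-! ### The sextic for the differences of the values of `g`, and its consequences. -/

/-- The sextic equation whose roots are the numbers `κ (g_i - g_j)`, where `κ² = k` and
`g_1, g_2, g_3` are the values of `g`. -/
def DifferenceSextic (k x y u : ℂ) : Prop :=
  (9 * y ^ 2 - 4 * x ^ 3) * u ^ 2 * ((9 * y ^ 2 - 4 * x ^ 3) * u ^ 2 + 9 * k * x) ^ 2 +
    243 * k ^ 3 * y ^ 2 = 0

/-- The values of `g`, in terms of a difference of two of them. -/
theorem cubic_of_differenceSextic {κ x y u : ℂ} (hκ : κ ≠ 0)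
    (hD : 9 * y ^ 2 - 4 * x ^ 3 ≠ 0) (h : DifferenceSextic (κ ^ 2) x y u) :
    (9 * y ^ 2 - 4 * x ^ 3) * u ^ 2 + 3 * κ ^ 2 * x ≠ 0 ∧
    ∀ g : ℂ, g = 3 * κ ^ 2 / ((9 * y ^ 2 - 4 * x ^ 3) * u ^ 2 + 3 * κ ^ 2 * x) →
    ((9 * y ^ 2 - 4 * x ^ 3) * g ^ 3 + 3 * x * g + 1 = 0) ∧
    ((9 * y ^ 2 - 4 * x ^ 3) * ((u / κ - g) / 2) ^ 3 + 3 * x * ((u / κ - g) / 2) + 1 = 0) := by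
  unfold DifferenceSextic at h
  set D := 9 * y ^ 2 - 4 * x ^ 3 with hDdef
  obtain ⟨v, rfl⟩ : ∃ v, u = κ * v := ⟨u / κ, by field_simp⟩
  have hv : κ * v / κ = v := by field_simp
  rw [hv]
  -- Up to a power of `D`, this is the equation `v² (v² + 3a)² + 4a³ + 27b² = 0` for root
  -- differences of `t³ + at + b`, with `a = 3x/D`, `b = 1/D`; and `D + 4x³ = 9y²`.
  have h' : D * v ^ 2 * (D * v ^ 2 + 9 * x) ^ 2 + 27 * (D + 4 * x ^ 3) = 0 := by
    apply mul_left_cancel₀ (pow_ne_zero 6 hκ)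
    rw [hDdef] at h ⊢
    linear_combination h
  have hA : D * v ^ 2 + 3 * x ≠ 0 := by
    intro h0
    apply hD
    have e : D * v ^ 2 = -3 * x := by linear_combination h0
    rw [e] at h'
    linear_combination h' / 27
  have hA' : D * (κ * v) ^ 2 + 3 * κ ^ 2 * x = κ ^ 2 * (D * v ^ 2 + 3 * x) := by ring
  refine ⟨by rw [hA']; exact mul_ne_zero (pow_ne_zero 2 hκ) hA, ?_⟩
  -- For `v = g₂ - g₃`, Vieta's formulas give `D v² + 3x = 3/g₁`, and `g₁ + g₂ + g₃ = 0` gives `g₂ =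
  -- (v - g₁)/2`.
  intro g hg
  have hAg : (D * v ^ 2 + 3 * x) * g = 3 := by
    rw [hg, hA']
    field_simp
  clear_value D
  have hDg : 3 * D * g ^ 2 = -(D * v ^ 2 + 12 * x) := by
    apply mul_left_cancel₀ (pow_ne_zero 2 hA)
    linear_combination (3 * D * ((D * v ^ 2 + 3 * x) * g + 3)) * hAg + h'
  constructor
  · linear_combination g / 3 * hDg - hAg / 3
  · linear_combination (v / 8 - g / 24) * hDg - hAg / 3

end AiryWKB
end

noncomputable section
namespace AiryWKB

open Filter Topology

/-- The equation `DifferenceSextic` implies the system. -/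
theorem solvesSystem_of_differenceSextic {W : Set (ℂ × ℂ)} (hW : IsOpen W) {u : ℂ × ℂ → ℂ}
    (hu : AnalyticOnNhd ℂ u W) {k : ℂ} (hk : k ≠ 0)
    (h : ∀ p ∈ W, DifferenceSextic k p.1 p.2 (u p)) : SolvesSystem W u := by
  obtain ⟨κ, rfl⟩ : ∃ κ : ℂ, k = κ ^ 2 := by
    obtain ⟨κ, hκ⟩ := IsAlgClosed.exists_pow_nat_eq k two_pos
    exact ⟨κ, hκ.symm⟩
  have hκ : κ ≠ 0 := by
    rintro rfl
    simp at hk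
  set V := W ∩ {p : ℂ × ℂ | 9 * p.2 ^ 2 - 4 * p.1 ^ 3 ≠ 0} with hVdef
  have hV : IsOpen V := hW.inter (isOpen_ne_fun (by fun_prop) continuous_const)
  -- Being rational in `u`, this value of `g` is analytic on `V` with no choice of branch. Together
  -- with the second value `(u/κ - g)/2` it recovers `u` linearly.
  set g : ℂ × ℂ → ℂ := fun p =>
    3 * κ ^ 2 / ((9 * p.2 ^ 2 - 4 * p.1 ^ 3) * u p ^ 2 + 3 * κ ^ 2 * p.1) with hg
  have huV : AnalyticOnNhd ℂ u V := hu.mono Set.inter_subset_left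
  have hD : AnalyticOnNhd ℂ (fun p : ℂ × ℂ => 9 * p.2 ^ 2 - 4 * p.1 ^ 3) V := fun z _ =>
    (analyticAt_const.mul (analyticAt_snd.pow 2)).sub (analyticAt_const.mul (analyticAt_fst.pow 3))
  have hga : AnalyticOnNhd ℂ g V :=
    analyticOnNhd_const.div ((hD.mul (huV.pow 2)).add (analyticOnNhd_const.mul
      (fun z _ => analyticAt_fst))) fun p hp => (cubic_of_differenceSextic hκ hp.2 (h p hp.1)).1
  have hg1 : IsCubicBranch V g :=
    ⟨hga, fun p hp => ((cubic_of_differenceSextic hκ hp.2 (h p hp.1)).2 _ rfl).1⟩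
  have hg2 : IsCubicBranch V fun p => (u p / κ - g p) / 2 :=
    ⟨((huV.div analyticOnNhd_const fun _ _ => hκ).sub hga).div analyticOnNhd_const
      fun _ _ => two_ne_zero,
      fun p hp => ((cubic_of_differenceSextic hκ hp.2 (h p hp.1)).2 _ rfl).2⟩
  have hs := (hg1.solvesSystem hV).linear_comb hg1.1 hg2.1 (hg2.solvesSystem hV) κ (2 * κ)
  have hu' : (fun p => κ * g p + 2 * κ * ((u p / κ - g p) / 2)) = u := by
    funext p
    field_simp
    ring
  rw [hu'] at hs
  refine solvesSystem_of_frequently hW hu fun p hp => ?_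
  refine ((frequently_ne_zero p).and_eventually (hW.mem_nhds hp)).mono ?_
  rintro z ⟨⟨-, hz⟩, hzW⟩ _ rfl
  exact hs _ ⟨hzW, hz⟩

theorem isAlgebraicFunctionOn_of_differenceSextic {W : Set (ℂ × ℂ)} {u : ℂ × ℂ → ℂ} {k : ℂ}
    (hk : k ≠ 0) (h : ∀ p ∈ W, DifferenceSextic k p.1 p.2 (u p)) :
    IsAlgebraicFunctionOn W u := by
  set D : MvPolynomial (Fin 3) ℂ := MvPolynomial.C 9 * MvPolynomial.X 1 ^ 2 -
    MvPolynomial.C 4 * MvPolynomial.X 0 ^ 3 with hD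
  set P : MvPolynomial (Fin 3) ℂ := D * MvPolynomial.X 2 ^ 2 *
    (D * MvPolynomial.X 2 ^ 2 + MvPolynomial.C (9 * k) * MvPolynomial.X 0) ^ 2 +
    MvPolynomial.C (243 * k ^ 3) * MvPolynomial.X 1 ^ 2 with hP
  have heval : ∀ x y z : ℂ, MvPolynomial.eval ![x, y, z] P =
      (9 * y ^ 2 - 4 * x ^ 3) * z ^ 2 * ((9 * y ^ 2 - 4 * x ^ 3) * z ^ 2 + 9 * k * x) ^ 2 +
        243 * k ^ 3 * y ^ 2 := by
    intro x y z
    simp [hP, hD]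
  refine ⟨P, fun h0 => ?_, fun p hp => ?_⟩
  -- At this point only `243 k³` survives.
  · have := heval 0 1 0
    rw [h0] at this
    simp [hk] at this
  · rw [heval]
    exact h p hp

/-- The vanishing of a product of analytic functions on a domain. -/
theorem eqOn_zero_or_of_mul_eq_zero {W : Set (ℂ × ℂ)} (hW : IsOpen W) (hW' : IsPreconnected W)
    {f g : ℂ × ℂ → ℂ} (hf : AnalyticOnNhd ℂ f W) (hg : AnalyticOnNhd ℂ g W)
    (h : ∀ p ∈ W, f p * g p = 0) : (∀ p ∈ W, f p = 0) ∨ ∀ p ∈ W, g p = 0 := by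
  by_contra! hne
  obtain ⟨⟨p, hp, hfp⟩, p', hp', hgp⟩ := hne
  refine hgp (hg.eqOn_zero_of_preconnected_of_eventuallyEq_zero hW' hp ?_ hp')
  filter_upwards [(hf p hp).continuousAt.eventually_ne hfp, hW.mem_nhds hp] with z hz hzW
  exact (mul_eq_zero.1 (h z hzW)).resolve_left hz

/-- The factorization of `DifferenceSextic` by two different values of `g`. -/
theorem differenceSextic_factor {κ x y u g₁ g₂ : ℂ}
    (h₁ : (9 * y ^ 2 - 4 * x ^ 3) * g₁ ^ 3 + 3 * x * g₁ + 1 = 0)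
    (h₂ : (9 * y ^ 2 - 4 * x ^ 3) * g₂ ^ 3 + 3 * x * g₂ + 1 = 0) (hne : g₁ ≠ g₂)
    (h : DifferenceSextic (κ ^ 2) x y u) :
    (u ^ 2 - κ ^ 2 * (g₁ - g₂) ^ 2) * ((u ^ 2 - κ ^ 2 * (2 * g₁ + g₂) ^ 2) *
      (u ^ 2 - κ ^ 2 * (g₁ + 2 * g₂) ^ 2)) = 0 := by
  unfold DifferenceSextic at h
  set D := 9 * y ^ 2 - 4 * x ^ 3 with hDdef
  have hy : 243 * κ ^ 6 * y ^ 2 = 27 * κ ^ 6 * (D + 4 * x ^ 3) := by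
    rw [hDdef]
    ring
  -- Vieta's formulas with third root `-g₁ - g₂`; the other two differences are then `2g₁ + g₂` and
  -- `g₁ + 2g₂`.
  have hx : D * (g₁ ^ 2 + g₁ * g₂ + g₂ ^ 2) + 3 * x = 0 := by
    apply mul_left_cancel₀ (sub_ne_zero.2 hne)
    linear_combination h₁ - h₂
  have h1 : D * (g₁ * g₂ * (g₁ + g₂)) = 1 := by
    linear_combination g₁ * hx - h₁
  have hD : D ≠ 0 := fun h0 => by simp [h0] at h1
  clear_value D
  have hx' : x = -D * (g₁ ^ 2 + g₁ * g₂ + g₂ ^ 2) / 3 := by linear_combination hx / 3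
  apply mul_left_cancel₀ (pow_ne_zero 3 hD)
  subst hx'
  have h1' : 27 * κ ^ 6 * D * (1 - (D * (g₁ * g₂ * (g₁ + g₂))) ^ 2) = 0 := by
    rw [h1]
    ring
  linear_combination h - hy - h1'

/-- Near a point where `g₁ ≠ g₂` the sextic factors; the identity theorem makes the product vanish
on `W`. Analytic functions on a domain have no zero divisors, so a single linear factor vanishes,
with the same constants throughout `W`. -/
theorem exists_linear_comb {W : Set (ℂ × ℂ)} (hW : IsOpen W) (hW' : IsPreconnected W)
    {u : ℂ × ℂ → ℂ} (hu : AnalyticOnNhd ℂ u W) {k : ℂ}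
    (h : ∀ p ∈ W, DifferenceSextic k p.1 p.2 (u p)) {g₁ g₂ : ℂ × ℂ → ℂ}
    (h₁ : IsCubicBranch W g₁) (h₂ : IsCubicBranch W g₂) (hne : ∃ p ∈ W, g₁ p ≠ g₂ p) :
    ∃ c₁ c₂ : ℂ, ∀ p ∈ W, u p = c₁ * g₁ p + c₂ * g₂ p := by
  obtain ⟨κ, rfl⟩ : ∃ κ : ℂ, k = κ ^ 2 := by
    obtain ⟨κ, hκ⟩ := IsAlgClosed.exists_pow_nat_eq k two_pos
    exact ⟨κ, hκ.symm⟩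
  obtain ⟨p₀, hp₀, hne⟩ := hne
  have hl : ∀ a b : ℂ, AnalyticOnNhd ℂ (fun p => a * g₁ p + b * g₂ p) W := fun a b =>
    (analyticOnNhd_const.mul h₁.1).add (analyticOnNhd_const.mul h₂.1)
  have hq : ∀ a b : ℂ, AnalyticOnNhd ℂ (fun p => u p ^ 2 - (a * g₁ p + b * g₂ p) ^ 2) W :=
    fun a b => (hu.pow 2).sub ((hl a b).pow 2)
  have hroot : ∀ a b : ℂ, (∀ p ∈ W, u p ^ 2 - (a * g₁ p + b * g₂ p) ^ 2 = 0) →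
      ∃ c₁ c₂ : ℂ, ∀ p ∈ W, u p = c₁ * g₁ p + c₂ * g₂ p := by
    intro a b hab
    rcases eqOn_zero_or_of_mul_eq_zero hW hW' (hu.sub (hl a b)) (hu.add (hl a b))
      (fun p hp => by
        have := hab p hp
        simp only [Pi.sub_apply, Pi.add_apply]
        linear_combination this) with h0 | h0
    · exact ⟨a, b, fun p hp => sub_eq_zero.1 (h0 p hp)⟩
    · refine ⟨-a, -b, fun p hp => ?_⟩
      have := h0 p hp
      simp only [Pi.add_apply] at this
      linear_combination this
  have h3 := (hq (2 * κ) κ).mul (hq κ (2 * κ))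
  have hzero := ((hq κ (-κ)).mul h3).eqOn_zero_of_preconnected_of_eventuallyEq_zero hW' hp₀ (by
    filter_upwards [hW.mem_nhds hp₀,
      ((h₁.1 p₀ hp₀).continuousAt.sub (h₂.1 p₀ hp₀).continuousAt).eventually_ne
        (sub_ne_zero.2 hne)] with p hp hpne
    have := differenceSextic_factor (h₁.2 p hp) (h₂.2 p hp) (sub_ne_zero.1 hpne) (h p hp)
    simp only [Pi.zero_apply]
    linear_combination this)
  rcases eqOn_zero_or_of_mul_eq_zero hW hW' (hq κ (-κ)) h3 (fun p hp => hzero hp) with h0 | h0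
  · exact hroot _ _ h0
  · rcases eqOn_zero_or_of_mul_eq_zero hW hW' (hq (2 * κ) κ) (hq κ (2 * κ)) h0 with h0 | h0
    · exact hroot _ _ h0
    · exact hroot _ _ h0

/-! ### The branches of the Borel transform satisfy the sextic. -/

theorem norm_borel_variable_lt (ε q σ : ℂ) (hε : ε = 1 ∨ ε = -1) (hq : q ≠ 0)
    (h : ‖σ ^ 2‖ < ‖2 * airyAction (q ^ 2)‖) : ‖3 / 4 * ε * σ ^ 2 / q ^ 6‖ < 1 := by
  have hε' : ‖ε‖ = 1 := by rcases hε with rfl | rfl <;> simp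
  have hq6 : 0 < ‖q ^ 6‖ := norm_pos_iff.2 (pow_ne_zero 6 hq)
  have e : 2 * airyAction (q ^ 2) = 4 / 3 * q ^ 6 := by
    rw [airyAction_eq _ (pow_ne_zero 2 hq)]
    ring
  rw [e, norm_mul] at h
  rw [norm_div, norm_mul, norm_mul, hε', div_lt_one hq6]
  norm_num at h ⊢
  linarith

/-- In terms of `w`, `9y² - 4x³ = -16 q¹² w (1 - w)`, and the square of the transform has the factor
`H²/w`. Their product is thus a multiple of `(1 - w) H²`, and the sextic reduces to
`hypFun_algebraic`. The constant `ε/π` arises from `Γ(1/2)² = π`. -/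
theorem differenceSextic_borel {ε q σ x y : ℂ} (hε : ε = 1 ∨ ε = -1) (hq : q ≠ 0) (hσ : σ ≠ 0)
    (hx : q ^ 4 = x) (hy : σ ^ 2 = y + ε * airyAction (q ^ 2))
    (hw : ‖3 / 4 * ε * σ ^ 2 / q ^ 6‖ < 1) :
    DifferenceSextic (ε / Real.pi) x y
      (q⁻¹ * σ⁻¹ * (Complex.Gamma (1 / 2))⁻¹ * hypFun (3 / 4 * ε * σ ^ 2 / q ^ 6)) := by
  have hJ := hypFun_algebraic hw
  generalize hwdef : 3 / 4 * ε * σ ^ 2 / q ^ 6 = w at *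
  generalize hypFun w = H at *
  have he2 : ε ^ 2 = 1 := by rcases hε with rfl | rfl <;> norm_num
  have hpi : (Real.pi : ℂ) ≠ 0 := by exact_mod_cast Real.pi_ne_zero
  have hG : Complex.Gamma (1 / 2) ^ 2 = Real.pi := by
    rw [Complex.Gamma_one_half_eq, ← Complex.cpow_nat_mul]
    norm_num
  have hσw : σ ^ 2 = 4 / 3 * ε * q ^ 6 * w := by
    rw [← hwdef]
    field_simp
    linear_combination -he2
  rw [airyAction_eq _ (pow_ne_zero 2 hq)] at hy
  have hy' : y = 2 / 3 * ε * q ^ 6 * (2 * w - 1) := by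
    linear_combination hσw - hy
  have hw0 : w ≠ 0 := by
    rintro rfl
    simp [hσ] at hσw
  have he0 : ε ≠ 0 := fun h => by simp [h] at he2
  have hu2 : (q⁻¹ * σ⁻¹ * (Complex.Gamma (1 / 2))⁻¹ * H) ^ 2 =
      3 * ε * H ^ 2 / (4 * Real.pi * q ^ 8 * w) := by
    rw [mul_pow, mul_pow, mul_pow, inv_pow, inv_pow, inv_pow, hG, hσw]
    field_simp
    linear_combination -H ^ 2 * he2
  have hD : 9 * y ^ 2 - 4 * x ^ 3 = -16 * q ^ 12 * w * (1 - w) := by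
    rw [hy', ← hx]
    linear_combination 4 * q ^ 12 * (2 * w - 1) ^ 2 * he2
  have hDu : (9 * y ^ 2 - 4 * x ^ 3) * (q⁻¹ * σ⁻¹ * (Complex.Gamma (1 / 2))⁻¹ * H) ^ 2 =
      -12 * (ε / Real.pi) * q ^ 4 * ((1 - w) * H ^ 2) := by
    rw [hD, hu2]
    field_simp
    ring
  rw [DifferenceSextic, hDu, hy', ← hx]
  generalize ε / (Real.pi : ℂ) = k
  linear_combination -108 * k ^ 3 * q ^ 12 * hJ +
    108 * k ^ 3 * q ^ 12 * (2 * w - 1) ^ 2 * he2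

/-- Every branch of the Borel transform is analytic on a domain, and satisfies the same sextic
equation. -/
theorem IsBorelBranch.differenceSextic {ε : ℂ} (hε : ε = 1 ∨ ε = -1) {W : Set (ℂ × ℂ)}
    {Ψ : ℂ × ℂ → ℂ} (h : IsBorelBranch ε W Ψ) :
    IsOpen W ∧ IsConnected W ∧ AnalyticOnNhd ℂ Ψ W ∧
      ∀ p ∈ W, DifferenceSextic (ε / Real.pi) p.1 p.2 (Ψ p) := by
  induction h with
  | sum W Ψ q σ hW hW' hq hσ hqx hσy hx hσ0 hdisc hΨ =>
    have hw : ∀ p ∈ W, ‖3 / 4 * ε * σ p ^ 2 / q p ^ 6‖ < 1 := fun p hp =>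
      norm_borel_variable_lt ε (q p) (σ p) hε (hx p hp) (hdisc p hp)
    have hΨ' : ∀ p ∈ W, Ψ p = (q p)⁻¹ * (σ p)⁻¹ * (Complex.Gamma (1 / 2))⁻¹ *
        hypFun (3 / 4 * ε * σ p ^ 2 / q p ^ 6) := by
      intro p hp
      rw [hΨ p hp, hypFun, ← tsum_mul_left]
      exact tsum_congr fun n => borelTerm_eq ε (q p) (σ p) hε (hx p hp) (hσ0 p hp) n
    refine ⟨hW, hW', ?_, fun p hp => ?_⟩
    · have hwa : AnalyticOnNhd ℂ (fun p => 3 / 4 * ε * σ p ^ 2 / q p ^ 6) W :=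
        (analyticOnNhd_const.mul (hσ.pow 2)).div (hq.pow 6) fun p hp => pow_ne_zero 6 (hx p hp)
      have hH := analyticOnNhd_hypFun.comp hwa fun p hp => mem_ball_zero_iff.2 (hw p hp)
      refine ((((hq.inv hx).mul (hσ.inv hσ0)).mul
        (analyticOnNhd_const (v := (Complex.Gamma (1 / 2))⁻¹))).mul hH).congr hW ?_
      exact fun p hp => (hΨ' p hp).symm
    · rw [hΨ' p hp]
      exact differenceSextic_borel hε (hx p hp) (hσ0 p hp) (hqx p hp) (hσy p hp) (hw p hp)
  | continuation W W' Ψ Ψ' _ hW hW' hΨ' p hp heq ih =>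
    refine ⟨hW, hW', hΨ', ?_⟩
    have hD : AnalyticOnNhd ℂ (fun p : ℂ × ℂ => 9 * p.2 ^ 2 - 4 * p.1 ^ 3) W' := fun z _ =>
      (analyticAt_const.mul (analyticAt_snd.pow 2)).sub
        (analyticAt_const.mul (analyticAt_fst.pow 3))
    have hDu := hD.mul (hΨ'.pow 2)
    have hfst : AnalyticOnNhd ℂ (fun p : ℂ × ℂ => 9 * (ε / Real.pi) * p.1) W' := fun z _ =>
      analyticAt_const.mul analyticAt_fst
    have hsnd : AnalyticOnNhd ℂ (fun p : ℂ × ℂ => 243 * (ε / Real.pi) ^ 3 * p.2 ^ 2) W' :=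
      fun z _ => analyticAt_const.mul (analyticAt_snd.pow 2)
    have hF := (hDu.mul ((hDu.add hfst).pow 2)).add hsnd
    -- Permanence of functional relations: the sextic expression in `Ψ'` is analytic on `W'` and
    -- vanishes near `p`.
    refine fun z hz => hF.eqOn_zero_of_preconnected_of_eventuallyEq_zero hW'.isPreconnected hp.2
      ?_ hz
    filter_upwards [heq, ih.1.mem_nhds hp.1] with z hz hzW
    have := ih.2.2.2 z hzW
    rw [← hz] at this
    exact this

end AiryWKB
end

theorem proposition4 (ε : ℂ) (hε : ε = 1 ∨ ε = -1) :
    -- the Borel transform converges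
    (∀ q σ : ℂ, q ≠ 0 → σ ≠ 0 → ‖σ ^ 2‖ < ‖2 * AiryWKB.airyAction (q ^ 2)‖ →
      Summable (AiryWKB.borelTerm ε q σ)) ∧
    -- the algebraic function `g` satisfies the system
    (∀ (W : Set (ℂ × ℂ)) (g : ℂ × ℂ → ℂ), IsOpen W → AiryWKB.IsCubicBranch W g →
      AiryWKB.SolvesSystem W g) ∧
    -- every branch of the Borel transform is holomorphic, satisfies the same system, is a linear
    -- combination of any two different branches of `g`, and is an algebraic function
    (∀ (W : Set (ℂ × ℂ)) (Ψ : ℂ × ℂ → ℂ), AiryWKB.IsBorelBranch ε W Ψ →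
      AnalyticOnNhd ℂ Ψ W ∧
      AiryWKB.SolvesSystem W Ψ ∧
      (∀ g₁ g₂ : ℂ × ℂ → ℂ, AiryWKB.IsCubicBranch W g₁ → AiryWKB.IsCubicBranch W g₂ →
        (∃ p ∈ W, g₁ p ≠ g₂ p) →
        ∃ c₁ c₂ : ℂ, ∀ p ∈ W, Ψ p = c₁ * g₁ p + c₂ * g₂ p) ∧
      AiryWKB.IsAlgebraicFunctionOn W Ψ) := by
  refine ⟨fun q σ hq hσ h => ?_, fun W g hW hg => hg.solvesSystem hW, fun W Ψ h => ?_⟩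
  · have hs := (AiryWKB.summable_mul_pow_of_le AiryWKB.norm_hypCoeff_le'
      (AiryWKB.norm_borel_variable_lt ε q σ hε hq h)).mul_left
      (q⁻¹ * σ⁻¹ * (Complex.Gamma (1 / 2))⁻¹)
    exact hs.congr fun n => (AiryWKB.borelTerm_eq ε q σ hε hq hσ n).symm
  · obtain ⟨hW, hW', hΨ, hsextic⟩ := h.differenceSextic hε
    have hk : ε / (Real.pi : ℂ) ≠ 0 := by
      have hpi : (Real.pi : ℂ) ≠ 0 := by exact_mod_cast Real.pi_ne_zero
      rcases hε with rfl | rfl <;> simp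
    exact ⟨hΨ, AiryWKB.solvesSystem_of_differenceSextic hW hΨ hk hsextic,
      fun g₁ g₂ h₁ h₂ hne =>
        AiryWKB.exists_linear_comb hW hW'.isPreconnected hΨ hsextic h₁ h₂ hne,
      AiryWKB.isAlgebraicFunctionOn_of_differenceSextic hk hsextic⟩
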